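/- Let $(M,g)$ be a smooth $n$-dimensional pseudo-Riemannian manifold of arbitrary signature, with contravariant metric $G=g^{-1}$ and Levi-Civita connection $\nabla$. A \emph{concircular tensor} is a smooth symmetric contravariant 2-tensor $L$ with $\nabla_k L_{ij}=\alpha_{(i}g_{j)k}$ for some covector field $\alpha$; it is an \emph{orthogonal concircular tensor} (OCT) if the $(1,1)$-tensor $L^i{}_j$ is point-wise diagonalizable over $\mathbb R$, and it is \emph{non-trivial} if it is not a multiple of $G$ when $n>1$. \emph{Associated product.} Coordinates on a connected open set $U$ are product coordinates $(x_0,x_1,\dots,x_k)$ of the product manifold $M_0\times M_1\times\dots\times M_k$ associated with the OCT $L$ if $U$ is the product of its projections to the groups of coordinates $x_0,\dots,x_k$; each coordinate field $\partial_a$ belonging to $x_0$ is an eigenvector of $L$ whose eigenvalue is simple at every point of $U$; and, for $1\le I\le k$, $\dim M_I>1$ and the fields $\partial_i$ belonging to $x_I$ span at every point the eigenspace of $L$ for a constant eigenvalue $e_I$, the $e_I$ being pairwise distinct. The factor $M_I$ is identified with a leaf (all coordinates outside $x_I$ held fixed) and carries the induced metric $g|_{M_I}$. \emph{KEM coordinates}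 are defined recursively: coordinates are Kalnins--Eisenhart--Miller (KEM) coordinates if, in a neighbourhood of each point, they are product coordinates $(x_0,x_1,\dots,x_k)$ of the product manifold associated with a non-trivial OCT and, for every $1\le I\le k$, $x_I$ are KEM coordinates on $(M_I,g|_{M_I})$. \textbf{Proposition.} Let $(x^1,\dots,x^n)$ be a coordinate system on an open subset of $M$ which is a system of KEM coordinates. Then 1. the coordinates are orthogonal: $g_{ij}=0$ for $i\ne j$; 2. the coordinates are separable: every point of the coordinate domain has an open neighbourhood $V$ on which the geodesic Hamilton--Jacobi equation $\tfrac12 g^{ij}\,\partial_iS\,\partial_jS=E$ has a smooth complete integral of the form $S(x,c)=\sum_{i=1}^n W_i(x^i,c)$, where $c$ ranges over a non-empty open subset of $\mathbb R^n$, $E=E(c)$, and $\det\left(\partial^2S/\partial x^i\partial c^j\right)\neq0$; 3. the coordinates have diagonal curvature: the Riemann curvature tensor satisfies $R_{ijik}=0$ for all $i$ and all $j\ne k$, in the coordinate induced basis. -/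

import Mathlib

open scoped Manifold ContDiff

noncomputable section

namespace KEM

/-! ### Tensor calculus in a coordinate domain

A coordinate domain is a subset `U` of `ι → ℝ`, and a (pseudo-Riemannian) metric on it is given by
its matrix of components `g x i j = g_{ij}(x)`. -/

section Coordinates

variable {ι : Type} [Fintype ι] [DecidableEq ι]

/-- The partial derivative `∂f/∂xᵢ`. -/
def pderiv (i : ι) (f : (ι → ℝ) → ℝ) (x : ι → ℝ) : ℝ :=
  fderiv ℝ f x (Pi.single i 1)

/-- The Christoffel symbol `Γ^m_{ij}` of the Levi-Civita connection of `g`. -/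
def christoffel (g : (ι → ℝ) → Matrix ι ι ℝ) (m i j : ι) (x : ι → ℝ) : ℝ :=
  (1 / 2) * ∑ l, (g x)⁻¹ m l *
    (pderiv i (fun y => g y l j) x + pderiv j (fun y => g y l i) x - pderiv l (fun y => g y i j) x)

/-- The components `R_{ijkl} = ⟨R(∂_k, ∂_l)∂_j, ∂_i⟩` of the Riemann curvature tensor, where
`R(X, Y)Z = ∇_X ∇_Y Z - ∇_Y ∇_X Z - ∇_{[X, Y]} Z`. -/
def riemann (g : (ι → ℝ) → Matrix ι ι ℝ) (i j k l : ι) (x : ι → ℝ) : ℝ :=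
  ∑ m, g x i m *
    (pderiv k (christoffel g m l j) x - pderiv l (christoffel g m k j) x
      + ∑ r, (christoffel g m k r x * christoffel g r l j x
        - christoffel g m l r x * christoffel g r k j x))

/-- The covariant derivative `∇_k T_{ij}` of a covariant 2-tensor. -/
def covDeriv (g T : (ι → ℝ) → Matrix ι ι ℝ) (k i j : ι) (x : ι → ℝ) : ℝ :=
  pderiv k (fun y => T y i j) x
    - ∑ m, christoffel g m k i x * T x m j - ∑ m, christoffel g m k j x * T x i m

/-- The covariant components `L_{ij} = g_{ip} L^{pq} g_{qj}` of a contravariant tensor. -/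
def lower (g L : (ι → ℝ) → Matrix ι ι ℝ) (x : ι → ℝ) : Matrix ι ι ℝ := g x * L x * g x

/-- The mixed components `L^i_j = L^{ip} g_{pj}` of a contravariant tensor. -/
def mixed (g L : (ι → ℝ) → Matrix ι ι ℝ) (x : ι → ℝ) : Matrix ι ι ℝ := L x * g x

/-- `L` (contravariant components `L^{ij}`) is a concircular tensor on `U`: a smooth symmetric tensor
with `∇_k L_{ij} = α_{(i} g_{j)k}` for some covector field `α`. -/
structure IsConcircular (U : Set (ι → ℝ)) (g L : (ι → ℝ) → Matrix ι ι ℝ) : Prop where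
  smooth : ∀ i j, ContDiffOn ℝ ∞ (fun x => L x i j) U
  symm : ∀ x ∈ U, (L x).IsSymm
  eqn : ∃ α : (ι → ℝ) → ι → ℝ, ∀ x ∈ U, ∀ i j k,
    covDeriv g (lower g L) k i j x = (1 / 2) * (α x i * g x j k + α x j * g x i k)

/-- An orthogonal concircular tensor (OCT): its (1,1)-tensor is point-wise diagonalizable (over `ℝ`). -/
structure IsOCT (U : Set (ι → ℝ)) (g L : (ι → ℝ) → Matrix ι ι ℝ) : Prop
    extends IsConcircular U g L where
  diagonalizable : ∀ x ∈ U, ∃ (P : Matrix ι ι ℝ) (d : ι → ℝ),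
    IsUnit P.det ∧ mixed g L x * P = P * Matrix.diagonal d

/-- `L` is non-trivial: not a multiple of the (contravariant) metric when the dimension exceeds 1. -/
def IsNontrivial (U : Set (ι → ℝ)) (g L : (ι → ℝ) → Matrix ι ι ℝ) : Prop :=
  1 < Fintype.card ι → ¬ ∃ f : (ι → ℝ) → ℝ, ∀ x ∈ U, L x = f x • (g x)⁻¹

/-- The coordinates on `U` are product coordinates `(x_0, x_1, …, x_k)` for the product manifold
`M_0 × M_1 × ⋯ × M_k` associated with the OCT `L`; here `b i = I` says that the `i`-th coordinate is
one of the coordinates `x_I` of the factor `M_I`. The coordinates `x_0` are those induced by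
`L` on `M_0`, i.e. each `∂_a` with `b a = 0` spans an eigenspace of `L`; the leaves of the `I`-th
foliation, `I ≠ 0`, are tangent to the eigenspace with constant eigenvalue `e I`. -/
structure IsAssociatedProduct (U : Set (ι → ℝ)) (g L : (ι → ℝ) → Matrix ι ι ℝ)
    {k : ℕ} (b : ι → Fin (k + 1)) : Prop where
  isOpen : IsOpen U
  connected : IsConnected U
  /-- `U` is the product of its projections to the factors. -/
  product : ∀ x : ι → ℝ, (∀ I, ∃ y ∈ U, ∀ j, b j = I → y j = x j) → x ∈ U
  /-- `dim M_I > 1` for `I > 0`. -/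
  dim : ∀ I, I ≠ 0 → 1 < Fintype.card {j // b j = I}
  eigen : ∃ (lam : (ι → ℝ) → ι → ℝ) (e : Fin (k + 1) → ℝ), ∀ x ∈ U,
    mixed g L x = Matrix.diagonal (lam x) ∧
    (∀ i, b i ≠ 0 → lam x i = e (b i)) ∧
    (∀ i j, lam x i = lam x j ↔ i = j ∨ (b i = b j ∧ b i ≠ 0))

/-- The point with coordinates `y` in the `I`-th factor and the coordinates of `p` in the others. -/
def leafPoint {k : ℕ} (b : ι → Fin (k + 1)) (I : Fin (k + 1)) (p : ι → ℝ)
    (y : {j // b j = I} → ℝ) : ι → ℝ :=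
  fun j => if h : b j = I then y ⟨j, h⟩ else p j

/-- The factor `M_I`, realized as the leaf through `p`, in the coordinates `x_I`. -/
def leafDomain {k : ℕ} (b : ι → Fin (k + 1)) (I : Fin (k + 1)) (p : ι → ℝ) (U : Set (ι → ℝ)) :
    Set ({j // b j = I} → ℝ) :=
  leafPoint b I p ⁻¹' U

/-- The metric `g|_{M_I}` induced on the leaf through `p`, in the coordinates `x_I`. -/
def leafMetric {k : ℕ} (b : ι → Fin (k + 1)) (I : Fin (k + 1)) (p : ι → ℝ)
    (g : (ι → ℝ) → Matrix ι ι ℝ) :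
    ({j // b j = I} → ℝ) → Matrix {j // b j = I} {j // b j = I} ℝ :=
  fun y => (g (leafPoint b I p y)).submatrix Subtype.val Subtype.val

end Coordinates

/-- The coordinates on `U`, with metric components `g`, are Kalnins-Eisenhart-Miller coordinates:
locally they are product coordinates of the product manifold of a non-trivial OCT, with KEM
coordinates on each factor `M_I`, `I ≥ 1` (a leaf through some point `p I`). -/
inductive IsKEM : {ι : Type} → [Fintype ι] → [DecidableEq ι] →
    Set (ι → ℝ) → ((ι → ℝ) → Matrix ι ι ℝ) → Prop
  | ofOCT {ι : Type} [Fintype ι] [DecidableEq ι] {U : Set (ι → ℝ)}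
      {g : (ι → ℝ) → Matrix ι ι ℝ} (L : (ι → ℝ) → Matrix ι ι ℝ)
      (oct : IsOCT U g L) (nontrivial : IsNontrivial U g L)
      {k : ℕ} (b : ι → Fin (k + 1)) (prod : IsAssociatedProduct U g L b)
      (p : Fin (k + 1) → ι → ℝ) (mem : ∀ I, p I ∈ U)
      (factor : ∀ I, I ≠ 0 → IsKEM (leafDomain b I (p I) U) (leafMetric b I (p I) g)) :
      IsKEM U g
  | ofLocal {ι : Type} [Fintype ι] [DecidableEq ι] {U : Set (ι → ℝ)}
      {g : (ι → ℝ) → Matrix ι ι ℝ} (V : (ι → ℝ) → Set (ι → ℝ))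
      (nhd : ∀ x ∈ U, IsOpen (V x) ∧ x ∈ V x ∧ V x ⊆ U)
      (kem : ∀ x ∈ U, IsKEM (V x) g) :
      IsKEM U g

section Conclusions

variable {ι : Type} [Fintype ι] [DecidableEq ι]

/-- `S (x, c)` is a complete integral, with parameters `c ∈ C` and energy `E c`, of the (geodesic)
Hamilton-Jacobi equation `(1/2) g^{ij} ∂_i S ∂_j S = E` on `V`. -/
structure IsCompleteIntegral (V C : Set (ι → ℝ)) (g : (ι → ℝ) → Matrix ι ι ℝ)
    (S : (ι → ℝ) → (ι → ℝ) → ℝ) (E : (ι → ℝ) → ℝ) : Prop where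
  smooth : ContDiffOn ℝ ∞ (fun q : (ι → ℝ) × (ι → ℝ) => S q.1 q.2) (V ×ˢ C)
  eqn : ∀ x ∈ V, ∀ c ∈ C,
    (1 / 2) * ∑ i, ∑ j, (g x)⁻¹ i j * pderiv i (fun y => S y c) x * pderiv j (fun y => S y c) x = E c
  complete : ∀ x ∈ V, ∀ c ∈ C,
    (Matrix.of fun i j => pderiv j (fun c' => pderiv i (fun y => S y c') x) c).det ≠ 0

/-- The coordinates are separable: near every point the Hamilton-Jacobi equation has a complete
integral of the form `S (x, c) = ∑ W_i (x_i, c)`. -/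
def IsSeparable (U : Set (ι → ℝ)) (g : (ι → ℝ) → Matrix ι ι ℝ) : Prop :=
  ∀ x₀ ∈ U, ∃ V : Set (ι → ℝ), IsOpen V ∧ x₀ ∈ V ∧ V ⊆ U ∧
    ∃ C : Set (ι → ℝ), IsOpen C ∧ C.Nonempty ∧
      ∃ (W : ι → ℝ → (ι → ℝ) → ℝ) (E : (ι → ℝ) → ℝ),
        IsCompleteIntegral V C g (fun x c => ∑ i, W i (x i) c) E

/-- The coordinates are orthogonal. -/
def IsOrthogonal (U : Set (ι → ℝ)) (g : (ι → ℝ) → Matrix ι ι ℝ) : Prop :=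
  ∀ x ∈ U, ∀ i j, i ≠ j → g x i j = 0

/-- The coordinates have diagonal curvature: `R_{ijik} = 0` for `j ≠ k`. -/
def IsDiagonalCurvature (U : Set (ι → ℝ)) (g : (ι → ℝ) → Matrix ι ι ℝ) : Prop :=
  ∀ x ∈ U, ∀ i j k, j ≠ k → riemann g i j i k x = 0

end Conclusions

/-! ### Coordinate systems on a pseudo-Riemannian manifold -/

/-- A smooth pseudo-Riemannian metric (of any signature) on a smooth `n`-manifold. -/
structure PseudoRiemannianMetric (n : ℕ) (M : Type*) [TopologicalSpace M]
    [ChartedSpace (EuclideanSpace ℝ (Fin n)) M] [IsManifold (𝓡 n) ∞ M] where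
  inner (x : M) : TangentSpace (𝓡 n) x →L[ℝ] TangentSpace (𝓡 n) x →L[ℝ] ℝ
  symm (x : M) (v w : TangentSpace (𝓡 n) x) : inner x v w = inner x w v
  nondegenerate (x : M) (v : TangentSpace (𝓡 n) x) (h : ∀ w, inner x v w = 0) : v = 0
  contMDiff : ContMDiff (𝓡 n)
    ((𝓡 n).prod 𝓘(ℝ, EuclideanSpace ℝ (Fin n) →L[ℝ] EuclideanSpace ℝ (Fin n) →L[ℝ] ℝ)) ∞
    (fun x => Bundle.TotalSpace.mk'
      (EuclideanSpace ℝ (Fin n) →L[ℝ] EuclideanSpace ℝ (Fin n) →L[ℝ] ℝ)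
      (E := fun x : M => TangentSpace (𝓡 n) x →L[ℝ] TangentSpace (𝓡 n) x →L[ℝ] ℝ) x (inner x))

section Manifold

variable {n : ℕ} {M : Type*} [TopologicalSpace M] [ChartedSpace (EuclideanSpace ℝ (Fin n)) M]
  [IsManifold (𝓡 n) ∞ M]

/-- A smooth (local) coordinate system `(x^1, …, x^n)` on `M`, with domain `φ.source`. -/
structure IsCoordinateSystem (φ : OpenPartialHomeomorph M (Fin n → ℝ)) : Prop where
  smooth : ContMDiffOn (𝓡 n) 𝓘(ℝ, Fin n → ℝ) ∞ φ φ.source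
  smooth_symm : ContMDiffOn 𝓘(ℝ, Fin n → ℝ) (𝓡 n) ∞ φ.symm φ.target

/-- The coordinate vector field `∂_i`, at the point with coordinates `y`. -/
def coordVector (φ : OpenPartialHomeomorph M (Fin n → ℝ)) (y : Fin n → ℝ) (i : Fin n) :
    TangentSpace (𝓡 n) (φ.symm y) :=
  mfderiv 𝓘(ℝ, Fin n → ℝ) (𝓡 n) φ.symm y (Pi.single i (1 : ℝ) : Fin n → ℝ)

/-- The components `g_{ij} = g(∂_i, ∂_j)` of the metric as functions of the coordinates. -/
def metricComponents (g : PseudoRiemannianMetric n M) (φ : OpenPartialHomeomorph M (Fin n → ℝ))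
    (y : Fin n → ℝ) : Matrix (Fin n) (Fin n) ℝ :=
  Matrix.of fun i j => g.inner (φ.symm y) (coordVector φ y i) (coordVector φ y j)

end Manifold

end KEM

end

set_option linter.unusedSectionVars false

namespace KEM

/-! ### Partial derivatives -/

section Calculus

variable {ι : Type} [Fintype ι] [DecidableEq ι] {U : Set (ι → ℝ)} {f h : (ι → ℝ) → ℝ}
  {x : ι → ℝ} {i j : ι}

/-! In product coordinates the mixed tensor is diagonal with entries `λ_i`. Concircularity then
becomes first-order equations (`IsConcircular.exists_isAdapted`): `g` is block diagonal along the
eigenspaces, a simple eigenvalue `λ_a` depends on `x_a` alone with `∂_a λ_a = α_a`, and `∂_i g_jk =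
α_i / (λ_i - λ_j) g_jk` whenever `j, k` share an eigenspace and `i` does not belong to it. Hence the
block of `M_I` is its leaf metric warped by `∏_a (e_I - λ_a)` (`IsAdapted.metric_eq_warped`), and on
`M_0` one has `g_aa = ψ_a(x_a) ∏_{r≠a} (λ_a - λ_r)` (`IsAdapted.exists_separated_form`). All three
conclusions follow from this normal form by induction on the recursive definition. Only one leaf of
each factor needs to be understood, since the others differ from it by a constant scale.

Orthogonality is immediate. For the curvature, the induction carries the Lamé equations, which force
`R_{ijik} = 0` in orthogonal coordinates. They are invariant under constant rescaling of the metric,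
so they pass from a leaf to the block it generates; for indices in different eigenspaces they come
from the first-order equations, and for three pairwise different eigenspaces from a partial fraction
identity (`IsAdapted.satisfiesLame`).

For separability, complete integrals on the factors are assumed. On `M_0` put `p_a² = ψ_a (P(λ_a) -
∑_I H_I / (e_I - λ_a))`, where `P` is a polynomial of degree less than `dim M_0` whose coefficients
in a suitable basis are the new parameters, and the `H_I` are the factor energies. Lagrange
interpolation (`sum_momentumSq_div`) sums `p_a² / g_aa` to the top coefficient of `P` minus `∑_I H_I
/ ∏_a (e_I - λ_a)`, and the subtracted terms are exactly what the factors contribute. The matrix of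
mixed derivatives is block triangular (`SeparationDatum.complete`). In arbitrary signature the
reality of `p_a` is not automatic: the parameters are chosen so that `p_a² = 1` at the base point,
which persists as positivity nearby (`IsAdapted.isSeparable`). -/

theorem differentiableAt_of_contDiffOn (hU : IsOpen U) (hf : ContDiffOn ℝ ∞ f U) (hx : x ∈ U) :
    DifferentiableAt ℝ f x :=
  (hf.contDiffAt (hU.mem_nhds hx)).differentiableAt (by simp)

theorem contDiffOn_pderiv (hU : IsOpen U) (hf : ContDiffOn ℝ ∞ f U) (i : ι) :
    ContDiffOn ℝ ∞ (pderiv i f) U :=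
  (hf.fderiv_of_isOpen hU (m := ∞) (by simp)).clm_apply contDiffOn_const

theorem pderiv_congr (hU : IsOpen U) (hfh : ∀ y ∈ U, f y = h y) (hx : x ∈ U) :
    pderiv i f x = pderiv i h x := by
  have : f =ᶠ[nhds x] h := Filter.eventuallyEq_of_mem (hU.mem_nhds hx) hfh
  rw [pderiv, pderiv, this.fderiv_eq]

theorem pderiv_const (c : ℝ) : pderiv i (fun _ : ι → ℝ => c) x = 0 := by
  simp [pderiv]

theorem pderiv_eq_zero_of_eqOn_const (hU : IsOpen U) {c : ℝ} (hf : ∀ y ∈ U, f y = c)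
    (hx : x ∈ U) : pderiv i f x = 0 := by
  rw [pderiv_congr hU hf hx, pderiv_const]

theorem pderiv_sub (hf : DifferentiableAt ℝ f x) (hh : DifferentiableAt ℝ h x) :
    pderiv i (fun y => f y - h y) x = pderiv i f x - pderiv i h x := by
  simp [pderiv, fderiv_fun_sub hf hh]

theorem pderiv_mul (hf : DifferentiableAt ℝ f x) (hh : DifferentiableAt ℝ h x) :
    pderiv i (fun y => f y * h y) x = pderiv i f x * h x + f x * pderiv i h x := by
  simp [pderiv, fderiv_fun_mul hf hh]; ring

theorem pderiv_const_mul (c : ℝ) (hf : DifferentiableAt ℝ f x) :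
    pderiv i (fun y => c * f y) x = c * pderiv i f x := by
  simp [pderiv, fderiv_const_mul hf]

theorem pderiv_inv (hf : DifferentiableAt ℝ f x) (h0 : f x ≠ 0) :
    pderiv i (fun y => (f y)⁻¹) x = -pderiv i f x / f x ^ 2 := by
  have := ((hasDerivAt_inv h0).comp_hasFDerivAt x hf.hasFDerivAt).fderiv
  simp only [pderiv]
  rw [show (fun y => (f y)⁻¹) = Inv.inv ∘ f from rfl, this]
  simp only [FunLike.coe_smul, Pi.smul_apply, smul_eq_mul]
  ring

theorem pderiv_div (hf : DifferentiableAt ℝ f x) (hh : DifferentiableAt ℝ h x) (h0 : h x ≠ 0) :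
    pderiv i (fun y => f y / h y) x
      = (pderiv i f x * h x - f x * pderiv i h x) / h x ^ 2 := by
  simp only [div_eq_mul_inv]
  rw [pderiv_mul hf (hh.fun_inv h0), pderiv_inv hh h0]
  field_simp
  ring

theorem pderiv_sum {κ : Type*} (s : Finset κ) {F : κ → (ι → ℝ) → ℝ}
    (hF : ∀ a ∈ s, DifferentiableAt ℝ (F a) x) :
    pderiv i (fun y => ∑ a ∈ s, F a y) x = ∑ a ∈ s, pderiv i (F a) x := by
  simp [pderiv, fderiv_fun_sum hF]

/-- Logarithmic differentiation of a product. -/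
theorem pderiv_prod_of_log {κ : Type*} (s : Finset κ) {F : κ → (ι → ℝ) → ℝ} {μ : κ → ℝ}
    (hF : ∀ a ∈ s, DifferentiableAt ℝ (F a) x)
    (hμ : ∀ a ∈ s, pderiv i (F a) x = μ a * F a x) :
    pderiv i (fun y => ∏ a ∈ s, F a y) x = (∑ a ∈ s, μ a) * ∏ a ∈ s, F a x := by
  classical
  induction s using Finset.induction_on with
  | empty => simp [pderiv_const]
  | insert a s ha ih =>
    simp only [Finset.prod_insert ha, Finset.sum_insert ha]
    rw [pderiv_mul (hF a (by simp))
        (HasFDerivAt.finsetProd (u := s)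
          fun b hb => (hF b (by simp [hb])).hasFDerivAt).differentiableAt,
      ih (fun b hb => hF b (by simp [hb])) (fun b hb => hμ b (by simp [hb])), hμ a (by simp)]
    ring

theorem pderiv_comm (hU : IsOpen U) (hf : ContDiffOn ℝ ∞ f U) (hx : x ∈ U) :
    pderiv i (pderiv j f) x = pderiv j (pderiv i f) x := by
  have hc : ContDiffAt ℝ ∞ f x := hf.contDiffAt (hU.mem_nhds hx)
  have hs : IsSymmSndFDerivAt ℝ f x := hc.isSymmSndFDerivAt (by
    rw [minSmoothness_of_isRCLikeNormedField]; exact WithTop.coe_le_coe.2 (le_top (a := (2 : ℕ∞))))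
  have hd : DifferentiableAt ℝ (fderiv ℝ f) x :=
    (hc.fderiv_right (m := 1) (by
      rw [one_add_one_eq_two]
      exact WithTop.coe_le_coe.2 (le_top (a := (2 : ℕ∞))))).differentiableAt (by simp)
  have key : ∀ v w : ι → ℝ,
      fderiv ℝ (fun y => fderiv ℝ f y v) x w = fderiv ℝ (fderiv ℝ f) x w v := by
    intro v w
    rw [fderiv_clm_apply hd (differentiableAt_const v)]
    simp
  change fderiv ℝ (fun y => fderiv ℝ f y _) x _ = fderiv ℝ (fun y => fderiv ℝ f y _) x _
  rw [key, key]
  exact hs _ _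

theorem fderiv_apply_eq_sum (v : ι → ℝ) : fderiv ℝ f x v = ∑ i, v i * pderiv i f x := by
  conv_lhs => rw [pi_eq_sum_univ' v, map_sum]
  simp only [map_smul, smul_eq_mul, pderiv]

/-- A function whose partial derivatives in the directions `P` vanish does not depend on these
variables, on a connected open set that allows exchanging them. -/
theorem eq_of_pderiv_eq_zero (hU : IsOpen U) (hc : IsPreconnected U) (P : ι → Prop)
    [DecidablePred P] (hP : ∀ x ∈ U, ∀ y ∈ U, (fun i => if P i then x i else y i) ∈ U)
    (hf : ∀ x ∈ U, DifferentiableAt ℝ f x)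
    (h0 : ∀ x ∈ U, ∀ i, P i → pderiv i f x = 0)
    {x y : ι → ℝ} (hx : x ∈ U) (hy : y ∈ U) (hxy : ∀ i, ¬ P i → x i = y i) : f x = f y := by
  -- `m` freezes the coordinates outside `P` at those of `y`. Then `f ∘ m` has zero derivative on
  -- `U`, and `m` fixes both `x` and `y`.
  let m : (ι → ℝ) → ι → ℝ := fun z i => if P i then z i else y i
  let m' : (ι → ℝ) →L[ℝ] (ι → ℝ) :=
    ContinuousLinearMap.pi fun i => if P i then ContinuousLinearMap.proj i else 0
  have hm : ∀ z, HasFDerivAt m m' z := by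
    intro z
    rw [hasFDerivAt_pi']
    intro i
    by_cases hi : P i
    · simpa [m, m', hi] using hasFDerivAt_apply (𝕜 := ℝ) i z
    · simpa [m, m', hi] using hasFDerivAt_const (y i) z
  have hd : ∀ z ∈ U, HasFDerivAt (fun z => f (m z)) ((fderiv ℝ f (m z)).comp m') z := fun z hz =>
    (hf _ (hP z hz y hy)).hasFDerivAt.comp z (hm z)
  have hconst := hU.is_const_of_fderiv_eq_zero (𝕜 := ℝ) (f := fun z => f (m z)) hc
    (fun z hz => (hd z hz).differentiableAt.differentiableWithinAt)
    (fun z hz => by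
      rw [(hd z hz).fderiv]
      ext v
      simp only [ContinuousLinearMap.comp_apply, Pi.zero_apply, zero_apply]
      rw [fderiv_apply_eq_sum]
      refine Finset.sum_eq_zero fun i _ => ?_
      by_cases hi : P i
      · rw [h0 _ (hP z hz y hy) i hi, mul_zero]
      · simp [m', hi]) hx hy
  have h1 : m x = x := by
    funext i; by_cases hi : P i <;> simp [m, hi]
    exact (hxy i hi).symm
  have h2 : m y = y := by
    funext i; simp [m]
  simpa [h1, h2] using hconst

end Calculus

/-! ### Primitives depending on parameters -/

section Primitive

open MeasureTheory

variable {E : Type*} [NormedAddCommGroup E] [NormedSpace ℝ E]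

/-- The integral is a convolution with parameters, evaluated at `0`, of the indicator of `(0, 1]`
with the integrand. A cutoff in `u` supplies the compact support needed for smoothness of such
convolutions. -/
theorem contDiffOn_parametric_unitIntegral {t₀ ε : ℝ} {C : Set E} (hC : IsOpen C)
    {F : ℝ × E → ℝ} (hF : ContDiffOn ℝ ∞ F (Metric.ball t₀ ε ×ˢ C)) {r : ℝ} (hr : 0 < r)
    (hrε : r < ε) :
    ContDiffOn ℝ ∞ (fun q : ℝ × E => ∫ u in (0 : ℝ)..1, F (t₀ + u * (q.1 - t₀), q.2))
      (Metric.ball t₀ r ×ˢ C) := by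
  have h1 : 1 < ε / r := by rwa [lt_div_iff₀ hr, one_mul]
  -- The cutoff is `1` for `|u| ≤ 1` and vanishes before `|u|` reaches `ε / r`, the bound up to
  -- which `t₀ + u (t - t₀)` stays in the `ε`-ball for every `t` in the `r`-ball.
  let χ : ContDiffBump (0 : ℝ) := ⟨1, (1 + ε / r) / 2, one_pos, by linarith⟩
  -- The sign of `u` is reversed because a convolution at `0` evaluates its second function at `-u`.
  let G : ℝ × E → ℝ → ℝ := fun q u => χ u * F (t₀ + -u * (q.1 - t₀), q.2)
  have hs : IsOpen (Metric.ball t₀ r ×ˢ C) := Metric.isOpen_ball.prod hC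
  have hconv := contDiffOn_convolution_right_with_param_comp (𝕜 := ℝ) (μ := volume)
    (n := ⊤) (ContinuousLinearMap.mul ℝ ℝ) (s := Metric.ball t₀ r ×ˢ C)
    (v := fun _ => (0 : ℝ)) contDiffOn_const
    (f := Set.indicator (Set.Ioc (0 : ℝ) 1) 1) (g := G) (k := Metric.closedBall 0 χ.rOut) hs
    (isCompact_closedBall _ _)
    (fun p u _ hu => by
      have : χ u = 0 := χ.zero_of_le_dist (by simpa using (le_of_lt (by simpa using hu)))
      simp [G, this])
    ((integrable_indicator_iff measurableSet_Ioc).2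
      (integrableOn_const (by simp))).locallyIntegrable
    (by
      rintro ⟨⟨t, c⟩, u⟩ ⟨⟨ht, hc⟩, -⟩
      rw [Metric.mem_ball, Real.dist_eq] at ht
      refine ContDiffAt.contDiffWithinAt ?_
      by_cases hu : |u| < ε / r
      · have hin : (t₀ + -u * (t - t₀), c) ∈ Metric.ball t₀ ε ×ˢ C := by
          refine ⟨?_, hc⟩
          simp only [Metric.mem_ball, Real.dist_eq, add_sub_cancel_left, abs_mul, abs_neg]
          calc |u| * |t - t₀| ≤ |u| * r := by gcongr
            _ < ε / r * r := by gcongr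
            _ = ε := by field_simp
        have hFa := hF.contDiffAt ((Metric.isOpen_ball.prod hC).mem_nhds hin)
        have hin2 : ContDiffAt ℝ ∞ (fun w : (ℝ × E) × ℝ =>
            ((t₀ + -w.2 * (w.1.1 - t₀), w.1.2) : ℝ × E)) ((t, c), u) := by
          apply ContDiff.contDiffAt; fun_prop
        have := hFa.comp ((t, c), u) hin2
        exact (χ.contDiff.contDiffAt.comp ((t, c), u) contDiffAt_snd).mul this
      · have hu' : χ.rOut < |u| := by
          have : χ.rOut = (1 + ε / r) / 2 := rfl
          push Not at hu; linarith
        refine (contDiffAt_const (c := (0 : ℝ))).congr_of_eventuallyEq ?_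
        have hev : ∀ᶠ w : (ℝ × E) × ℝ in nhds ((t, c), u), χ.rOut < |w.2| :=
          (isOpen_lt continuous_const (by fun_prop)).mem_nhds hu'
        filter_upwards [hev] with w hw
        have : χ w.2 = 0 := χ.zero_of_le_dist (by simpa using hw.le)
        simp [Function.HasUncurry.uncurry, G, this])
  refine hconv.congr fun q _ => ?_
  rw [intervalIntegral.integral_of_le zero_le_one, MeasureTheory.convolution,
    ← integral_indicator measurableSet_Ioc]
  congr 1
  funext u
  by_cases hu : u ∈ Set.Ioc (0 : ℝ) 1
  · have : χ (-u) = 1 := χ.one_of_mem_closedBall (by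
      have : |u| ≤ 1 := abs_le.2 ⟨by linarith [hu.1], hu.2⟩
      simpa [χ] using this)
    simp [hu, G, this]
  · simp [hu]

/-- Rescaling the interval of integration gives `(t - t₀) ∫₀¹ F (t₀ + u (t - t₀), c) du`, so the
moving endpoint becomes a parameter of the integrand. -/
theorem contDiffOn_parametric_primitive {t₀ ε : ℝ} {C : Set E} (hC : IsOpen C)
    {F : ℝ × E → ℝ} (hF : ContDiffOn ℝ ∞ F (Metric.ball t₀ ε ×ˢ C)) :
    ContDiffOn ℝ ∞ (fun q : ℝ × E => ∫ s in t₀..q.1, F (s, q.2)) (Metric.ball t₀ ε ×ˢ C) := by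
  rintro ⟨t, c⟩ ⟨ht, hc⟩
  obtain ⟨r, htr, hrε⟩ := exists_between (Metric.mem_ball.1 ht)
  have hr : 0 < r := dist_nonneg.trans_lt htr
  have hint := (contDiffOn_parametric_unitIntegral hC hF hr hrε).contDiffAt
    ((Metric.isOpen_ball.prod hC).mem_nhds (show (t, c) ∈ Metric.ball t₀ r ×ˢ C from ⟨htr, hc⟩))
  have hsub : ContDiffAt ℝ ∞ (fun q : ℝ × E => q.1 - t₀) (t, c) := by
    apply ContDiff.contDiffAt; fun_prop
  refine ((hsub.mul hint).congr_of_eventuallyEq (.of_forall fun q => ?_)).contDiffWithinAt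
  have := intervalIntegral.smul_integral_comp_add_mul (fun s => F (s, q.2)) (a := 0) (b := 1)
    (q.1 - t₀) t₀
  simp only [mul_zero, add_zero, mul_one, add_sub_cancel, smul_eq_mul] at this
  simp only [← this, mul_comm]

theorem hasDerivAt_parametric_primitive {t₀ ε : ℝ} {f : ℝ → ℝ}
    (hf : ContinuousOn f (Metric.ball t₀ ε)) {t : ℝ} (ht : t ∈ Metric.ball t₀ ε) :
    HasDerivAt (fun t => ∫ s in t₀..t, f s) (f t) t := by
  have hε : 0 < ε := dist_nonneg.trans_lt (Metric.mem_ball.1 ht)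
  refine intervalIntegral.integral_hasDerivAt_right ?_ ?_
    (hf.continuousAt (Metric.isOpen_ball.mem_nhds ht))
  · exact (hf.mono ((convex_ball t₀ ε).ordConnected.uIcc_subset
      (Metric.mem_ball_self hε) ht)).intervalIntegrable
  · exact hf.stronglyMeasurableAtFilter Metric.isOpen_ball _ ht

end Primitive

/-! ### Metrics in a coordinate domain -/

/-- `g` is a smooth pseudo-Riemannian metric on the open set `U`. -/
structure IsMetricOn {ι : Type} [Fintype ι] [DecidableEq ι] (U : Set (ι → ℝ))
    (g : (ι → ℝ) → Matrix ι ι ℝ) : Prop where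
  isOpen : IsOpen U
  smooth : ∀ i j, ContDiffOn ℝ ∞ (fun x => g x i j) U
  symm : ∀ x ∈ U, ∀ i j, g x i j = g x j i
  det_ne_zero : ∀ x ∈ U, (g x).det ≠ 0

section Metric

variable {ι : Type} [Fintype ι] [DecidableEq ι] {U : Set (ι → ℝ)} {g : (ι → ℝ) → Matrix ι ι ℝ}

theorem IsMetricOn.mono (hg : IsMetricOn U g) {V : Set (ι → ℝ)} (hV : IsOpen V) (hVU : V ⊆ U) :
    IsMetricOn V g :=
  ⟨hV, fun i j => (hg.smooth i j).mono hVU, fun x hx => hg.symm x (hVU hx),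
    fun x hx => hg.det_ne_zero x (hVU hx)⟩

theorem IsMetricOn.differentiableAt (hg : IsMetricOn U g) {x : ι → ℝ} (hx : x ∈ U) (i j : ι) :
    DifferentiableAt ℝ (fun x => g x i j) x :=
  differentiableAt_of_contDiffOn hg.isOpen (hg.smooth i j) hx

theorem eq_diagonal_of_offDiag_eq_zero {A : Matrix ι ι ℝ} (h : ∀ i j, i ≠ j → A i j = 0) :
    A = Matrix.diagonal fun i => A i i := by
  ext i j
  by_cases hij : i = j
  · simp [hij]
  · simp [hij, h i j hij]

theorem diag_ne_zero_of_offDiag_eq_zero {A : Matrix ι ι ℝ} (h : ∀ i j, i ≠ j → A i j = 0)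
    (hA : A.det ≠ 0) (i : ι) : A i i ≠ 0 := by
  rw [eq_diagonal_of_offDiag_eq_zero h, Matrix.det_diagonal] at hA
  exact Finset.prod_ne_zero_iff.1 hA i (Finset.mem_univ i)

theorem inv_apply_of_offDiag_eq_zero {A : Matrix ι ι ℝ} (h : ∀ i j, i ≠ j → A i j = 0)
    (hA : A.det ≠ 0) (i j : ι) : A⁻¹ i j = if i = j then (A i i)⁻¹ else 0 := by
  have h0 := diag_ne_zero_of_offDiag_eq_zero h hA
  have : A⁻¹ = Matrix.diagonal fun i => (A i i)⁻¹ := by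
    apply Matrix.inv_eq_right_inv
    nth_rewrite 1 [eq_diagonal_of_offDiag_eq_zero h]
    rw [Matrix.diagonal_mul_diagonal, ← Matrix.diagonal_one]
    congr 1
    funext i
    exact mul_inv_cancel₀ (h0 i)
  rw [this, Matrix.diagonal_apply]

/-! ### Curvature of orthogonal coordinates -/

/-- The equation `∂_j ∂_k H_i = ∂_k (log H_j) ∂_j H_i + ∂_j (log H_k) ∂_k H_i` for the Lamé
coefficients of orthogonal coordinates, expressed through the components `g_ii = ± H_i²`. -/
def SatisfiesLame (U : Set (ι → ℝ)) (g : (ι → ℝ) → Matrix ι ι ℝ) : Prop :=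
  ∀ x ∈ U, ∀ i j k, i ≠ j → i ≠ k → j ≠ k →
    pderiv k (pderiv j fun y => g y i i) x = (1 / 2) *
      (pderiv j (fun y => g y i i) x * pderiv k (fun y => g y i i) x / g x i i
        + pderiv j (fun y => g y i i) x * pderiv k (fun y => g y j j) x / g x j j
        + pderiv k (fun y => g y i i) x * pderiv j (fun y => g y k k) x / g x k k)

variable {x : ι → ℝ}

theorem IsOrthogonal.christoffel_eq (hg : IsMetricOn U g) (ho : IsOrthogonal U g) (hx : x ∈ U)
    (m i j : ι) : christoffel g m i j x = (1 / 2) * ((g x m m)⁻¹ *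
      (pderiv i (fun y => g y m j) x + pderiv j (fun y => g y m i) x
        - pderiv m (fun y => g y i j) x)) := by
  unfold christoffel
  rw [Finset.sum_eq_single m]
  · rw [inv_apply_of_offDiag_eq_zero (ho x hx) (hg.det_ne_zero x hx), if_pos rfl]
  · intro l _ hl
    rw [inv_apply_of_offDiag_eq_zero (ho x hx) (hg.det_ne_zero x hx), if_neg hl.symm, zero_mul]
  · simp

theorem IsOrthogonal.pderiv_eq_zero (hg : IsMetricOn U g) (ho : IsOrthogonal U g) (hx : x ∈ U)
    {i j : ι} (hij : i ≠ j) (k : ι) : pderiv k (fun y => g y i j) x = 0 :=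
  pderiv_eq_zero_of_eqOn_const hg.isOpen (fun y hy => ho y hy i j hij) hx

theorem IsOrthogonal.christoffel_distinct (hg : IsMetricOn U g) (ho : IsOrthogonal U g)
    (hx : x ∈ U) {m i j : ι} (hmi : m ≠ i) (hmj : m ≠ j) (hij : i ≠ j) :
    christoffel g m i j x = 0 := by
  rw [ho.christoffel_eq hg hx, ho.pderiv_eq_zero hg hx hmi, ho.pderiv_eq_zero hg hx hmj,
    ho.pderiv_eq_zero hg hx hij]
  ring

theorem IsOrthogonal.christoffel_self_left (hg : IsMetricOn U g) (ho : IsOrthogonal U g)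
    (hx : x ∈ U) (i j : ι) :
    christoffel g i i j x = (1 / 2) * (pderiv j (fun y => g y i i) x / g x i i) := by
  rw [ho.christoffel_eq hg hx, add_sub_right_comm, sub_self, zero_add]
  ring

theorem IsOrthogonal.christoffel_self_right (hg : IsMetricOn U g) (ho : IsOrthogonal U g)
    (hx : x ∈ U) (i j : ι) :
    christoffel g i j i x = (1 / 2) * (pderiv j (fun y => g y i i) x / g x i i) := by
  have h : pderiv i (fun y => g y i j) x = pderiv i (fun y => g y j i) x :=
    pderiv_congr hg.isOpen (fun y hy => hg.symm y hy i j) hx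
  rw [ho.christoffel_eq hg hx, h, add_sub_assoc, sub_self, add_zero]
  ring

theorem IsOrthogonal.christoffel_twice (hg : IsMetricOn U g) (ho : IsOrthogonal U g)
    (hx : x ∈ U) {i k : ι} (hik : i ≠ k) :
    christoffel g i k k x = -(1 / 2) * (pderiv i (fun y => g y k k) x / g x i i) := by
  rw [ho.christoffel_eq hg hx, ho.pderiv_eq_zero hg hx hik]
  ring

theorem IsOrthogonal.ne_zero (hg : IsMetricOn U g) (ho : IsOrthogonal U g)
    (hx : x ∈ U) (i : ι) : g x i i ≠ 0 :=
  diag_ne_zero_of_offDiag_eq_zero (ho x hx) (hg.det_ne_zero x hx) i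

theorem IsOrthogonal.pderiv_christoffel_self (hg : IsMetricOn U g) (ho : IsOrthogonal U g)
    (hx : x ∈ U) (i j k : ι) :
    pderiv k (christoffel g i i j) x = (1 / 2) * (pderiv k (pderiv j fun y => g y i i) x / g x i i
      - pderiv j (fun y => g y i i) x * pderiv k (fun y => g y i i) x / g x i i ^ 2) := by
  have h0 := ho.ne_zero hg hx i
  have hd := hg.differentiableAt hx i i
  have hp := differentiableAt_of_contDiffOn hg.isOpen
    (contDiffOn_pderiv hg.isOpen (hg.smooth i i) j) hx
  rw [pderiv_congr hg.isOpen (fun y hy => ho.christoffel_self_left hg hy i j) hx,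
    pderiv_const_mul _ (by simp only [div_eq_mul_inv]; exact hp.fun_mul (hd.fun_inv h0)),
    pderiv_div hp hd h0]
  field_simp

/-- Orthogonality leaves only `m = i` in the outer sum. If `i = k` the component vanishes by
antisymmetry, if `i = j` by symmetry of second derivatives; for distinct indices the remaining
Christoffel terms cancel by the Lamé equation for `g_ii`. -/
theorem IsOrthogonal.isDiagonalCurvature (hg : IsMetricOn U g) (ho : IsOrthogonal U g)
    (hl : SatisfiesLame U g) : IsDiagonalCurvature U g := by
  intro x hx i j k hjk
  have h0 := ho.ne_zero hg hx
  unfold riemann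
  rw [Finset.sum_eq_single i (fun m _ hm => by rw [ho x hx i m hm.symm, zero_mul]) (by simp)]
  by_cases hik : i = k
  · subst hik; simp
  by_cases hij : i = j
  · subst hij
    rw [pderiv_congr hg.isOpen (fun y hy => show christoffel g i k i y = christoffel g i i k y by
        rw [ho.christoffel_self_left hg hy, ho.christoffel_self_right hg hy]) hx,
      ho.pderiv_christoffel_self hg hx, ho.pderiv_christoffel_self hg hx,
      pderiv_comm (i := i) hg.isOpen (hg.smooth i i) hx,
      ← Finset.sum_subset (Finset.subset_univ {i, k}), Finset.sum_pair hik]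
    · rw [ho.christoffel_self_left hg hx i k, ho.christoffel_self_left hg hx k i,
        ho.christoffel_self_left hg hx i i, ho.christoffel_self_right hg hx i k,
        ho.christoffel_twice hg hx hik, ho.christoffel_twice hg hx (Ne.symm hik)]
      have := h0 i
      have := h0 k
      field_simp
      ring
    · intro r _ hr
      simp only [Finset.mem_insert, Finset.mem_singleton, not_or] at hr
      rw [ho.christoffel_distinct hg hx hr.2 hr.1 (Ne.symm hik),
        ho.christoffel_distinct hg hx hik (Ne.symm hr.1) (Ne.symm hr.2)]
      ring
  · rw [pderiv_eq_zero_of_eqOn_const hg.isOpen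
        (fun y hy => ho.christoffel_distinct hg hy hik hij (Ne.symm hjk)) hx,
      ho.pderiv_christoffel_self hg hx, hl x hx i j k hij hik hjk,
      ← Finset.sum_subset (Finset.subset_univ {i, j, k}),
      Finset.sum_insert (by simp [hij, hik]), Finset.sum_pair hjk]
    · rw [ho.christoffel_distinct hg hx hik hij (Ne.symm hjk),
        ho.christoffel_distinct hg hx (Ne.symm hik) (Ne.symm hjk) hij,
        ho.christoffel_self_left hg hx i j, ho.christoffel_self_left hg hx i k,
        ho.christoffel_self_right hg hx j k, ho.christoffel_self_left hg hx k j,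
        ho.christoffel_self_right hg hx i k]
      have := h0 i
      have := h0 j
      have := h0 k
      field_simp
      ring
    · intro r _ hr
      simp only [Finset.mem_insert, Finset.mem_singleton, not_or] at hr
      rw [ho.christoffel_distinct hg hx hr.2.2 hr.2.1 (Ne.symm hjk),
        ho.christoffel_distinct hg hx hik (Ne.symm hr.1) (Ne.symm hr.2.2)]
      ring

end Metric

/-! ### The metric in coordinates adapted to an orthogonal concircular tensor -/

/-- The coordinates `i` and `j` belong to the same eigenspace. -/
def SameEigenspace {ι : Type} {k : ℕ} (b : ι → Fin (k + 1)) (i j : ι) : Prop :=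
  i = j ∨ (b i = b j ∧ b i ≠ 0)

/-- The equations satisfied by the metric and the eigenvalues `lam` of a concircular tensor in
product coordinates; `α` is the covector field of the concircular tensor. -/
structure IsAdapted {ι : Type} [Fintype ι] [DecidableEq ι] (U : Set (ι → ℝ))
    (g : (ι → ℝ) → Matrix ι ι ℝ) {k : ℕ} (b : ι → Fin (k + 1)) (lam α : (ι → ℝ) → ι → ℝ)
    (e : Fin (k + 1) → ℝ) : Prop where
  lam_smooth : ∀ i, ContDiffOn ℝ ∞ (fun x => lam x i) U
  lam_eq_iff : ∀ x ∈ U, ∀ i j, lam x i = lam x j ↔ SameEigenspace b i j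
  lam_const : ∀ x ∈ U, ∀ i, b i ≠ 0 → lam x i = e (b i)
  alpha_eq_zero : ∀ x ∈ U, ∀ i, b i ≠ 0 → α x i = 0
  pderiv_lam : ∀ x ∈ U, ∀ i k, pderiv k (fun y => lam y i) x = if i = k then α x i else 0
  block : ∀ x ∈ U, ∀ i j, ¬ SameEigenspace b i j → g x i j = 0
  pderiv_metric : ∀ x ∈ U, ∀ i j k, SameEigenspace b j k → ¬ SameEigenspace b i j →
    (lam x i - lam x j) * pderiv i (fun y => g y j k) x = α x i * g x j k

section SameEigenspace

variable {ι : Type} {k : ℕ} {b : ι → Fin (k + 1)} {i j l : ι}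

theorem SameEigenspace.symm (h : SameEigenspace b i j) : SameEigenspace b j i := by
  rcases h with h | ⟨h, h'⟩
  · exact .inl h.symm
  · exact .inr ⟨h.symm, h ▸ h'⟩

theorem SameEigenspace.trans (h : SameEigenspace b i j) (h' : SameEigenspace b j l) :
    SameEigenspace b i l := by
  rcases h with rfl | ⟨h1, h2⟩
  · exact h'
  · rcases h' with rfl | ⟨h3, -⟩
    · exact .inr ⟨h1, h2⟩
    · exact .inr ⟨h1.trans h3, h2⟩

theorem SameEigenspace.ne_zero (h : SameEigenspace b i j) (hij : i ≠ j) : b i ≠ 0 :=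
  h.resolve_left hij |>.2

end SameEigenspace

/-! ### Concircularity in product coordinates: the first-order equations for metric and eigenvalues
-/

section Structure

variable {ι : Type} [Fintype ι] [DecidableEq ι] {U : Set (ι → ℝ)} {g L : (ι → ℝ) → Matrix ι ι ℝ}
  {x : ι → ℝ} {k : ℕ} {b : ι → Fin (k + 1)}

/-- Lowering the upper index cancels the inverse metric and leaves the Christoffel symbols of the
first kind. -/
theorem IsMetricOn.sum_christoffel_mul (hg : IsMetricOn U g) (hx : x ∈ U) (i j k : ι) :
    ∑ m, christoffel g m k i x * g x m j = (1 / 2) * (pderiv k (fun y => g y j i) x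
      + pderiv i (fun y => g y j k) x - pderiv j (fun y => g y k i) x) := by
  have hinv : g x * (g x)⁻¹ = 1 := Matrix.mul_nonsing_inv _ (hg.det_ne_zero x hx).isUnit
  have hinv' : ∀ l, ∑ m, g x j m * (g x)⁻¹ m l = if j = l then 1 else 0 := by
    intro l
    rw [← Matrix.mul_apply, hinv, Matrix.one_apply]
  set X : ι → ℝ := fun l => pderiv k (fun y => g y l i) x
      + pderiv i (fun y => g y l k) x - pderiv l (fun y => g y k i) x with hX
  calc ∑ m, christoffel g m k i x * g x m j
      = ∑ m, ∑ l, (1 / 2) * (g x j m * (g x)⁻¹ m l * X l) := by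
        refine Finset.sum_congr rfl fun m _ => ?_
        rw [christoffel, Finset.mul_sum, Finset.sum_mul]
        refine Finset.sum_congr rfl fun l _ => ?_
        rw [hg.symm x hx m j]
        ring
    _ = ∑ l, (1 / 2) * ((∑ m, g x j m * (g x)⁻¹ m l) * X l) := by
        rw [Finset.sum_comm]
        refine Finset.sum_congr rfl fun l _ => ?_
        rw [Finset.sum_mul, Finset.mul_sum]
    _ = (1 / 2) * X j := by simp [hinv']

theorem IsMetricOn.pderiv_symm (hg : IsMetricOn U g) (hx : x ∈ U) (i j k : ι) :
    pderiv k (fun y => g y i j) x = pderiv k (fun y => g y j i) x :=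
  pderiv_congr hg.isOpen (fun y hy => hg.symm y hy i j) hx

theorem lower_apply_of_mixed_eq_diagonal {d : ι → ℝ} (h : mixed g L x = Matrix.diagonal d)
    (i j : ι) : lower g L x i j = g x i j * d j := by
  rw [lower, Matrix.mul_assoc, show L x * g x = Matrix.diagonal d from h, Matrix.mul_diagonal]

theorem IsConcircular.lower_symm (hg : IsMetricOn U g) (hL : IsConcircular U g L) (hx : x ∈ U)
    (i j : ι) : lower g L x i j = lower g L x j i := by
  have hgs : (g x).transpose = g x := by ext i j; exact hg.symm x hx j i
  have : (lower g L x).transpose = lower g L x := by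
    rw [lower, Matrix.transpose_mul, Matrix.transpose_mul, hgs, hL.symm x hx, Matrix.mul_assoc]
  exact congrFun (congrFun this j) i

theorem exists_apply_ne_zero_of_det_ne_zero {A : Matrix ι ι ℝ} (hA : A.det ≠ 0) (i : ι) :
    ∃ j, A i j ≠ 0 := by
  by_contra! h
  exact hA (Matrix.det_eq_zero_of_row_eq_zero i h)

/-- Since `L_ij = g_ij λ_j = λ_i g_ij`, each connection term is an eigenvalue times a Christoffel
symbol of the first kind, so no inverse metric remains. -/
theorem IsConcircular.covDeriv_lower (hg : IsMetricOn U g) (hL : IsConcircular U g L)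
    {lam : (ι → ℝ) → ι → ℝ} (hlam : ∀ x ∈ U, mixed g L x = Matrix.diagonal (lam x))
    (hd : ∀ x ∈ U, ∀ i, DifferentiableAt ℝ (fun y => lam y i) x) (hx : x ∈ U) (i j k : ι) :
    covDeriv g (lower g L) k i j x
      = pderiv k (fun y => g y i j) x * lam x j + g x i j * pderiv k (fun y => lam y j) x
        - lam x j * ((1 / 2) * (pderiv k (fun y => g y j i) x
          + pderiv i (fun y => g y j k) x - pderiv j (fun y => g y k i) x))
        - lam x i * ((1 / 2) * (pderiv k (fun y => g y i j) x
          + pderiv j (fun y => g y i k) x - pderiv i (fun y => g y k j) x)) := by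
  rw [covDeriv, pderiv_congr hg.isOpen
    (fun y hy => lower_apply_of_mixed_eq_diagonal (hlam y hy) i j) hx,
    pderiv_mul (hg.differentiableAt hx i j) (hd x hx j), ← hg.sum_christoffel_mul hx i j k,
    ← hg.sum_christoffel_mul hx j i k, Finset.mul_sum, Finset.mul_sum]
  congr 1
  · congr 1
    refine Finset.sum_congr rfl fun m _ => ?_
    rw [lower_apply_of_mixed_eq_diagonal (hlam x hx)]
    ring
  · refine Finset.sum_congr rfl fun m _ => ?_
    rw [hL.lower_symm hg hx, lower_apply_of_mixed_eq_diagonal (hlam x hx)]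
    ring

/-- Each property reads off one component of the equation: symmetry of `L_ij` gives the blocks, `∇_k
L_ii` the derivatives of the eigenvalues, and `∇_k L_ij` with `i` outside the eigenspace of `j, k`
the derivatives of the metric. -/
theorem IsConcircular.exists_isAdapted (hg : IsMetricOn U g) (hL : IsConcircular U g L)
    (hb : IsAssociatedProduct U g L b) : ∃ lam α e, IsAdapted U g b lam α e := by
  obtain ⟨lam, e, hle⟩ := hb.eigen
  obtain ⟨α, hα⟩ := hL.eqn
  have hU := hg.isOpen
  have hlam : ∀ x ∈ U, mixed g L x = Matrix.diagonal (lam x) := fun x hx => (hle x hx).1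
  have hsm : ∀ i, ContDiffOn ℝ ∞ (fun x => lam x i) U := by
    intro i
    have : ContDiffOn ℝ ∞ (fun x => ∑ p, L x i p * g x p i) U :=
      ContDiffOn.sum fun p _ => (hL.smooth i p).mul (hg.smooth p i)
    refine this.congr fun x hx => ?_
    rw [← Matrix.mul_apply, show L x * g x = _ from hlam x hx, Matrix.diagonal_apply_eq]
  have hd : ∀ x ∈ U, ∀ i, DifferentiableAt ℝ (fun y => lam y i) x := fun x hx i =>
    differentiableAt_of_contDiffOn hU (hsm i) hx
  have heq : ∀ x ∈ U, ∀ i j, lam x i = lam x j ↔ SameEigenspace b i j :=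
    fun x hx i j => (hle x hx).2.2 i j
  have hblock : ∀ x ∈ U, ∀ i j, ¬ SameEigenspace b i j → g x i j = 0 := by
    intro x hx i j hij
    have h := hL.lower_symm hg hx i j
    rw [lower_apply_of_mixed_eq_diagonal (hlam x hx),
      lower_apply_of_mixed_eq_diagonal (hlam x hx), hg.symm x hx j i] at h
    have hne : lam x i - lam x j ≠ 0 := fun h0 => hij ((heq x hx i j).1 (sub_eq_zero.1 h0))
    have : g x i j * (lam x i - lam x j) = 0 := by linear_combination -h
    exact (mul_eq_zero.1 this).resolve_right hne
  -- For equal indices the derivatives of the metric cancel from `∇_k L_ii`.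
  have hdiag : ∀ x ∈ U, ∀ i k, g x i i * pderiv k (fun y => lam y i) x = α x i * g x i k := by
    intro x hx i k
    have h := hα x hx i i k
    rw [hL.covDeriv_lower hg hlam hd hx, hg.pderiv_symm hx i k] at h
    linear_combination h
  have hconst : ∀ x ∈ U, ∀ i, b i ≠ 0 → ∀ k, pderiv k (fun y => lam y i) x = 0 :=
    fun x hx i hi k => pderiv_eq_zero_of_eqOn_const hU (fun y hy => (hle y hy).2.1 i hi) hx
  -- For a constant eigenvalue the diagonal equation reads `α_i g_ij = 0` for all `j`, and
  -- nondegeneracy provides a nonzero entry in row `i`.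
  have hα0 : ∀ x ∈ U, ∀ i, b i ≠ 0 → α x i = 0 := by
    intro x hx i hi
    obtain ⟨j, hj⟩ := exists_apply_ne_zero_of_det_ne_zero (hg.det_ne_zero x hx) i
    have h := hdiag x hx i j
    rw [hconst x hx i hi, mul_zero] at h
    exact (mul_eq_zero.1 h.symm).resolve_right hj
  refine ⟨lam, α, e, hsm, heq, fun x hx => (hle x hx).2.1, hα0, ?_, hblock, ?_⟩
  · intro x hx i k
    -- For a simple eigenvalue the off-diagonal part of row `i` vanishes, so `g_ii ≠ 0` may be
    -- cancelled.
    by_cases hi : b i = 0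
    · have hrow : ∀ j, i ≠ j → g x i j = 0 := fun j hij =>
        hblock x hx i j fun h => h.ne_zero hij hi
      have h0 : g x i i ≠ 0 := by
        obtain ⟨j, hj⟩ := exists_apply_ne_zero_of_det_ne_zero (hg.det_ne_zero x hx) i
        by_cases hij : i = j
        · rwa [← hij] at hj
        · exact absurd (hrow j hij) hj
      have h := hdiag x hx i k
      split_ifs with hik
      · subst hik
        rw [mul_comm] at h
        exact mul_right_cancel₀ h0 h
      · rw [hrow k hik, mul_zero] at h
        exact (mul_eq_zero.1 h).resolve_left h0
    · rw [hconst x hx i hi, hα0 x hx i hi, ite_self]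
  · intro x hx i j k hjk hij
    have hik : ¬ SameEigenspace b i k := fun h => hij (h.trans hjk.symm)
    have hz : ∀ p q, ¬ SameEigenspace b p q → ∀ r, pderiv r (fun y => g y p q) x = 0 :=
      fun p q hpq r => pderiv_eq_zero_of_eqOn_const hU (fun y hy => hblock y hy p q hpq) hx
    have h := hα x hx i j k
    rw [hL.covDeriv_lower hg hlam hd hx, hblock x hx i j hij, hblock x hx i k hik,
      hg.pderiv_symm hx j i, hg.pderiv_symm hx k i, hz i j hij, hz i k hik,
      hg.pderiv_symm hx k j] at h
    -- With `g_ij = g_ik = 0` on all of `U`, only `∂_i g_jk` survives; the factor `2` clears the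
    -- symmetrization and Christoffel halves.
    linear_combination 2 * h

end Structure

section Leaves

variable {ι : Type} [Fintype ι] [DecidableEq ι] {U : Set (ι → ℝ)} {g L : (ι → ℝ) → Matrix ι ι ℝ}
  {x p : ι → ℝ} {k : ℕ} {b : ι → Fin (k + 1)} {I : Fin (k + 1)}

/-! ### Leaves of a product -/

/-- The coordinates of `x` in the `I`-th factor. -/
def restrictTo (b : ι → Fin (k + 1)) (I : Fin (k + 1)) (x : ι → ℝ) : {j // b j = I} → ℝ :=
  fun j => x j

theorem contDiff_restrictTo : ContDiff ℝ ∞ (restrictTo b I) :=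
  contDiff_pi.2 fun j => contDiff_apply ℝ ℝ j.1

theorem contDiff_leafPoint (p : ι → ℝ) : ContDiff ℝ ∞ (leafPoint b I p) := by
  refine contDiff_pi.2 fun j => ?_
  by_cases h : b j = I
  · simpa [leafPoint, h] using contDiff_apply ℝ ℝ (⟨j, h⟩ : {j // b j = I})
  · simpa [leafPoint, h] using contDiff_const

theorem pderiv_comp_restrictTo {h : ({j // b j = I} → ℝ) → ℝ}
    (hh : DifferentiableAt ℝ h (restrictTo b I x)) (i : ι) (hi : b i = I) :
    pderiv i (fun z => h (restrictTo b I z)) x = pderiv ⟨i, hi⟩ h (restrictTo b I x) := by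
  let ℓ : (ι → ℝ) →L[ℝ] ({j // b j = I} → ℝ) :=
    ContinuousLinearMap.pi fun j => ContinuousLinearMap.proj j.1
  have hℓ : HasFDerivAt (restrictTo b I) ℓ x := ℓ.hasFDerivAt
  have := (hh.hasFDerivAt.comp x hℓ).fderiv
  simp only [pderiv]
  rw [show (fun z => h (restrictTo b I z)) = h ∘ restrictTo b I from rfl, this,
    ContinuousLinearMap.comp_apply]
  congr 1
  funext j
  simp [ℓ, Pi.single_apply, Subtype.ext_iff]

theorem pderiv_comp_restrictTo_of_ne {h : ({j // b j = I} → ℝ) → ℝ}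
    (hh : DifferentiableAt ℝ h (restrictTo b I x)) (i : ι) (hi : b i ≠ I) :
    pderiv i (fun z => h (restrictTo b I z)) x = 0 := by
  let ℓ : (ι → ℝ) →L[ℝ] ({j // b j = I} → ℝ) :=
    ContinuousLinearMap.pi fun j => ContinuousLinearMap.proj j.1
  have hℓ : HasFDerivAt (restrictTo b I) ℓ x := ℓ.hasFDerivAt
  have := (hh.hasFDerivAt.comp x hℓ).fderiv
  simp only [pderiv]
  rw [show (fun z => h (restrictTo b I z)) = h ∘ restrictTo b I from rfl, this,
    ContinuousLinearMap.comp_apply, show ℓ (Pi.single i 1) = 0 by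
      funext j
      have : j.1 ≠ i := fun hji => hi (hji ▸ j.2)
      simp [ℓ, this], map_zero]

theorem IsAssociatedProduct.mix_mem (hb : IsAssociatedProduct U g L b) (Q : Fin (k + 1) → Prop)
    [DecidablePred Q] {x y : ι → ℝ} (hx : x ∈ U) (hy : y ∈ U) :
    (fun i => if Q (b i) then x i else y i) ∈ U := by
  refine hb.product _ fun I => ?_
  by_cases hI : Q I
  · exact ⟨x, hx, fun j hj => by simp [hj, hI]⟩
  · exact ⟨y, hy, fun j hj => by simp [hj, hI]⟩

theorem leafPoint_restrictTo_eq (x p : ι → ℝ) :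
    leafPoint b I p (restrictTo b I x) = fun i => if b i = I then x i else p i := by
  funext j
  simp [leafPoint, restrictTo]

theorem IsAssociatedProduct.leafPoint_mem (hb : IsAssociatedProduct U g L b) (hp : p ∈ U)
    (hx : x ∈ U) : leafPoint b I p (restrictTo b I x) ∈ U := by
  rw [leafPoint_restrictTo_eq]
  exact hb.mix_mem (· = I) hx hp

/-! ### The leaf metrics -/

variable {lam α : (ι → ℝ) → ι → ℝ} {e : Fin (k + 1) → ℝ}

/-- The block structure makes the extension by zero of a kernel vector of the leaf metric a kernel
vector of `g`. -/
theorem IsAdapted.leafMetric_det_ne_zero (ha : IsAdapted U g b lam α e) (hg : IsMetricOn U g)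
    {y : {j // b j = I} → ℝ} (hy : y ∈ leafDomain b I p U) :
    (leafMetric b I p g y).det ≠ 0 := by
  intro h0
  obtain ⟨v, hv, hv0⟩ := Matrix.exists_mulVec_eq_zero_iff.2 h0
  have hmem : leafPoint b I p y ∈ U := hy
  apply hg.det_ne_zero _ hmem
  refine Matrix.exists_mulVec_eq_zero_iff.1
    ⟨fun i => if h : b i = I then v ⟨i, h⟩ else 0, fun hw => hv ?_, ?_⟩
  · funext j
    have := congrFun hw j.1
    simpa [j.2] using this
  · funext i
    by_cases hi : b i = I
    · have h1 := congrFun hv0 ⟨i, hi⟩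
      simp only [Matrix.mulVec, dotProduct, leafMetric, Matrix.submatrix_apply,
        Pi.zero_apply] at h1 ⊢
      refine Eq.trans ?_ h1
      rw [← Finset.sum_filter_of_ne (p := fun j => b j = I), Finset.sum_subtype
        (Finset.univ.filter fun j => b j = I) (p := fun j => b j = I) (by simp)]
      · exact Finset.sum_congr rfl fun j _ => by simp [j.2]
      · intro j _ hj
        by_contra h
        simp [h] at hj
    · simp only [Matrix.mulVec, dotProduct, Pi.zero_apply]
      refine Finset.sum_eq_zero fun j _ => ?_
      by_cases hj : b j = I
      · rw [ha.block _ hmem i j, zero_mul]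
        rintro (rfl | ⟨h, -⟩)
        · exact hi hj
        · exact hi (h.trans hj)
      · simp [hj]

theorem IsAdapted.isMetricOn_leafMetric (ha : IsAdapted U g b lam α e) (hg : IsMetricOn U g) :
    IsMetricOn (leafDomain b I p U) (leafMetric b I p g) where
  isOpen := hg.isOpen.preimage (contDiff_leafPoint p).continuous
  smooth i j := (hg.smooth i.1 j.1).comp (contDiff_leafPoint p).contDiffOn fun _ hy => hy
  symm _ hy i j := hg.symm _ hy i.1 j.1
  det_ne_zero _ hy := ha.leafMetric_det_ne_zero hg hy

/-! ### The warping functions -/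

/-- The function `∏ (e - λ_a)`, the product over the simple eigenvalues. -/
def warpingFunction (b : ι → Fin (k + 1)) (lam : (ι → ℝ) → ι → ℝ) (c : ℝ) (x : ι → ℝ) : ℝ :=
  ∏ a with b a = 0, (c - lam x a)

theorem IsAdapted.lam_ne (ha : IsAdapted U g b lam α e) (hx : x ∈ U) {i j : ι}
    (h : ¬ SameEigenspace b i j) : lam x i - lam x j ≠ 0 :=
  fun h0 => h ((ha.lam_eq_iff x hx i j).1 (sub_eq_zero.1 h0))

theorem IsAdapted.sub_lam_ne_zero (ha : IsAdapted U g b lam α e)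
    (hb : IsAssociatedProduct U g L b) (hx : x ∈ U) (hI : I ≠ 0) {a : ι} (h0 : b a = 0) :
    e I - lam x a ≠ 0 := by
  obtain ⟨i⟩ : Nonempty {j // b j = I} := Fintype.card_pos_iff.1 (zero_lt_one.trans (hb.dim I hI))
  have hi : b i.1 ≠ 0 := by rw [i.2]; exact hI
  have h := ha.lam_const x hx i.1 hi
  rw [i.2] at h
  rw [← h]
  refine ha.lam_ne hx ?_
  rintro (h | ⟨h, -⟩)
  · exact hi (h ▸ h0)
  · exact hi (h.trans h0)

theorem IsAdapted.warpingFunction_ne_zero (ha : IsAdapted U g b lam α e)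
    (hb : IsAssociatedProduct U g L b) (hx : x ∈ U) (hI : I ≠ 0) :
    warpingFunction b lam (e I) x ≠ 0 :=
  Finset.prod_ne_zero_iff.2 fun _ h =>
    ha.sub_lam_ne_zero hb hx hI (Finset.mem_filter.1 h).2

theorem IsAdapted.contDiffOn_warpingFunction (ha : IsAdapted U g b lam α e) (c : ℝ) :
    ContDiffOn ℝ ∞ (warpingFunction b lam c) U :=
  contDiffOn_prod fun i _ => contDiffOn_const.sub (ha.lam_smooth i)

/-- Among the factors only `e_I - λ_i` can depend on `x_i`. If `i` does not belong to `M_0` there is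
no such factor, and the right side vanishes because `α_i = 0`. -/
theorem IsAdapted.pderiv_warpingFunction (ha : IsAdapted U g b lam α e)
    (hb : IsAssociatedProduct U g L b) (hg : IsMetricOn U g) (hx : x ∈ U) (hI : I ≠ 0) (i : ι) :
    pderiv i (warpingFunction b lam (e I)) x
      = α x i / (lam x i - e I) * warpingFunction b lam (e I) x := by
  have hd : ∀ a, DifferentiableAt ℝ (fun y => lam y a) x := fun a =>
    differentiableAt_of_contDiffOn hg.isOpen (ha.lam_smooth a) hx
  have := pderiv_prod_of_log (i := i) (x := x) (Finset.univ.filter fun a => b a = 0)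
    (F := fun a y => e I - lam y a) (μ := fun a => if a = i then α x i / (lam x i - e I) else 0)
    (fun a _ => (differentiableAt_const _).sub (hd a)) (fun a h => by
      have hne := ha.sub_lam_ne_zero hb hx hI (Finset.mem_filter.1 h).2
      rw [pderiv_sub (differentiableAt_const _) (hd a), pderiv_const, ha.pderiv_lam x hx]
      split_ifs with hai
      · subst hai
        have hne' : lam x a - e I ≠ 0 := fun h => hne (by linarith)
        field_simp
        ring
      · simp)
  rw [show warpingFunction b lam (e I) = fun y => ∏ a with b a = 0, (e I - lam y a) from rfl, this]
  congr 1
  by_cases hi : b i = 0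
  · simp [hi]
  · simp [ha.alpha_eq_zero x hx i hi]

theorem IsAdapted.warpingFunction_leafPoint (ha : IsAdapted U g b lam α e)
    (hb : IsAssociatedProduct U g L b) (hg : IsMetricOn U g) (hx : x ∈ U) (hp : p ∈ U)
    (hI : I ≠ 0) :
    warpingFunction b lam (e I) (leafPoint b I p (restrictTo b I x))
      = warpingFunction b lam (e I) p := by
  refine eq_of_pderiv_eq_zero hg.isOpen hb.connected.isPreconnected (fun i => b i = I)
    (fun x hx y hy => hb.mix_mem (· = I) hx hy)
    (fun x hx => differentiableAt_of_contDiffOn hg.isOpen (ha.contDiffOn_warpingFunction _) hx)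
    (fun z hz i hi => ?_) (hb.leafPoint_mem hp hx) hp (fun i hi => ?_)
  · rw [ha.pderiv_warpingFunction hb hg hz hI, ha.alpha_eq_zero z hz i (hi ▸ hI)]
    simp
  · simp [leafPoint, hi]

/-- The metric on an eigenspace of dimension `> 1` is a warped leaf metric. -/
theorem IsAdapted.metric_eq_warped (ha : IsAdapted U g b lam α e)
    (hb : IsAssociatedProduct U g L b) (hg : IsMetricOn U g) (hx : x ∈ U) (hp : p ∈ U)
    (hI : I ≠ 0) (j l : {j // b j = I}) :
    g x j l = warpingFunction b lam (e I) x / warpingFunction b lam (e I) p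
      * leafMetric b I p g (restrictTo b I x) j l := by
  have hw : ∀ z ∈ U, DifferentiableAt ℝ (warpingFunction b lam (e I)) z := fun z hz =>
    differentiableAt_of_contDiffOn hg.isOpen (ha.contDiffOn_warpingFunction _) hz
  -- In every direction outside `x_I`, the entry `g_jl` and the warping function satisfy the same
  -- linear first-order equation, so their quotient depends on `x_I` only.
  have h := eq_of_pderiv_eq_zero (f := fun z => g z j l * (warpingFunction b lam (e I) z)⁻¹)
    hg.isOpen hb.connected.isPreconnected (fun i => b i ≠ I)
    (fun x hx y hy => hb.mix_mem (· ≠ I) hx hy)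
    (fun z hz => (hg.differentiableAt hz _ _).fun_mul
      ((hw z hz).fun_inv (ha.warpingFunction_ne_zero hb hz hI)))
    (fun z hz i hi => ?_) hx (hb.leafPoint_mem (I := I) hp hx) (fun i hi => ?_)
  · rw [ha.warpingFunction_leafPoint hb hg hx hp hI] at h
    have h1 := ha.warpingFunction_ne_zero hb hx hI
    have h2 := ha.warpingFunction_ne_zero hb hp hI
    rw [← div_eq_mul_inv, ← div_eq_mul_inv, div_eq_div_iff h1 h2] at h
    rw [div_mul_eq_mul_div, eq_div_iff h2, h, mul_comm]
    rfl
  · have hj0 : b j.1 ≠ 0 := by rw [j.2]; exact hI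
    have hjl : SameEigenspace b j.1 l.1 := .inr ⟨j.2.trans l.2.symm, hj0⟩
    have hij : ¬ SameEigenspace b i j.1 := by
      rintro (h | ⟨h, -⟩)
      · exact hi (h ▸ j.2)
      · exact hi (h.trans j.2)
    have hne := ha.lam_ne hz hij
    have hw0 := ha.warpingFunction_ne_zero hb hz hI
    have hm := ha.pderiv_metric z hz i j.1 l.1 hjl hij
    have hlj : lam z j.1 = e I := by rw [ha.lam_const z hz _ hj0, j.2]
    rw [hlj] at hm hne
    rw [pderiv_mul (hg.differentiableAt hz _ _) ((hw z hz).fun_inv hw0), pderiv_inv (hw z hz) hw0,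
      ha.pderiv_warpingFunction hb hg hz hI, eq_div_of_mul_eq hne ((mul_comm _ _).trans hm)]
    field_simp
    ring
  · push Not at hi
    simp [leafPoint, restrictTo, hi]

theorem IsAdapted.isOrthogonal (ha : IsAdapted U g b lam α e)
    (hb : IsAssociatedProduct U g L b) (hg : IsMetricOn U g) {p : Fin (k + 1) → ι → ℝ}
    (hp : ∀ I, p I ∈ U)
    (ho : ∀ I, I ≠ 0 → IsOrthogonal (leafDomain b I (p I) U) (leafMetric b I (p I) g)) :
    IsOrthogonal U g := by
  intro x hx i j hij
  by_cases h : SameEigenspace b i j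
  · obtain ⟨h1, h2⟩ := h.resolve_left hij
    have h3 := ha.metric_eq_warped hb hg hx (hp (b j)) (h1 ▸ h2) ⟨i, h1⟩ ⟨j, rfl⟩
    rw [ho (b j) (h1 ▸ h2) _ (hb.leafPoint_mem (hp _) hx) _ _ (by simpa using hij),
      mul_zero] at h3
    exact h3
  · exact ha.block x hx i j h

/-! ### The Lamé equations -/

theorem IsAdapted.pderiv_diag (ha : IsAdapted U g b lam α e) (hx : x ∈ U) {i j : ι}
    (h : ¬ SameEigenspace b j i) :
    pderiv j (fun y => g y i i) x = g x i i * (α x j / (lam x j - lam x i)) := by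
  have hne := ha.lam_ne hx h
  have := ha.pderiv_metric x hx j i i (.inl rfl) h
  field_simp
  linear_combination this

/-- In `∂_j g_ii = g_ii α_j / (λ_j - λ_i)` the second factor does not depend on `x_l`: neither
eigenvalue does, and `∂_l α_j = ∂_j ∂_l λ_j = 0`. -/
theorem IsAdapted.pderiv_pderiv_diag (ha : IsAdapted U g b lam α e) (hg : IsMetricOn U g)
    (hx : x ∈ U) {i j l : ι} (h : ¬ SameEigenspace b j i) (hij : l ≠ i) (hlj : l ≠ j) :
    pderiv l (pderiv j fun y => g y i i) x
      = pderiv l (fun y => g y i i) x * (α x j / (lam x j - lam x i)) := by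
  have hU := hg.isOpen
  have hne := ha.lam_ne hx h
  have hαs : ∀ y ∈ U, α y j = pderiv j (fun z => lam z j) y := fun y hy => by
    simp [ha.pderiv_lam y hy]
  have hαd : DifferentiableAt ℝ (fun y => α y j) x :=
    differentiableAt_of_contDiffOn hU ((contDiffOn_pderiv hU (ha.lam_smooth j) j).congr hαs) hx
  have hα : pderiv l (fun y => α y j) x = 0 := by
    rw [pderiv_congr hU hαs hx, pderiv_comm hU (ha.lam_smooth j) hx]
    exact pderiv_eq_zero_of_eqOn_const hU (fun y hy => by
      rw [ha.pderiv_lam y hy, if_neg hlj.symm]) hx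
  have hld : ∀ m, DifferentiableAt ℝ (fun y => lam y m) x := fun m =>
    differentiableAt_of_contDiffOn hU (ha.lam_smooth m) hx
  have hsub := (hld j).fun_sub (hld i)
  rw [pderiv_congr hU (fun y hy => ha.pderiv_diag hy h) hx,
    pderiv_mul (hg.differentiableAt hx i i)
      (by simp only [div_eq_mul_inv]; exact hαd.fun_mul (hsub.fun_inv hne)),
    pderiv_div hαd hsub hne, pderiv_sub (hld j) (hld i), hα, ha.pderiv_lam x hx,
    ha.pderiv_lam x hx, if_neg hij.symm, if_neg hlj.symm]
  simp

/-- Along the leaf the warping factor `r` is constant, and both sides of the Lamé equation are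
homogeneous of degree one in the metric, so the equation of the leaf metric is multiplied by `r`. -/
theorem IsAdapted.satisfiesLame_of_sameEigenspace (ha : IsAdapted U g b lam α e)
    (hb : IsAssociatedProduct U g L b) (hg : IsMetricOn U g) (hp : p ∈ U) (hI : I ≠ 0)
    (ho : IsOrthogonal U g) (hl : SatisfiesLame (leafDomain b I p U) (leafMetric b I p g))
    (hx : x ∈ U) {i j l : ι} (hi : b i = I) (hj : b j = I) (hlI : b l = I) (hij : i ≠ j)
    (hil : i ≠ l) (hjl : j ≠ l) :
    pderiv l (pderiv j fun y => g y i i) x = (1 / 2) *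
      (pderiv j (fun y => g y i i) x * pderiv l (fun y => g y i i) x / g x i i
        + pderiv j (fun y => g y i i) x * pderiv l (fun y => g y j j) x / g x j j
        + pderiv l (fun y => g y i i) x * pderiv j (fun y => g y l l) x / g x l l) := by
  have hU := hg.isOpen
  have hgI := ha.isMetricOn_leafMetric (p := p) (I := I) hg
  set r : (ι → ℝ) → ℝ := fun z =>
    (warpingFunction b lam (e I) p)⁻¹ * warpingFunction b lam (e I) z with hr
  have hw : ∀ z ∈ U, DifferentiableAt ℝ (warpingFunction b lam (e I)) z := fun z hz =>
    differentiableAt_of_contDiffOn hU (ha.contDiffOn_warpingFunction _) hz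
  have hrd : ∀ z ∈ U, DifferentiableAt ℝ r z := fun z hz => (hw z hz).const_mul _
  have hr0 : ∀ z ∈ U, ∀ m, b m = I → pderiv m r z = 0 := fun z hz m hm => by
    rw [pderiv_const_mul _ (hw z hz), ha.pderiv_warpingFunction hb hg hz hI,
      ha.alpha_eq_zero z hz m (hm ▸ hI)]
    simp
  have hmem : ∀ z ∈ U, restrictTo b I z ∈ leafDomain b I p U := fun z hz =>
    hb.leafPoint_mem hp hz
  have hscale : ∀ (f : (ι → ℝ) → ℝ) (h : ({j // b j = I} → ℝ) → ℝ),
      ContDiffOn ℝ ∞ h (leafDomain b I p U) → (∀ z ∈ U, f z = r z * h (restrictTo b I z)) →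
      ∀ z ∈ U, ∀ m (hm : b m = I), pderiv m f z = r z * pderiv ⟨m, hm⟩ h (restrictTo b I z) := by
    intro f h hh hf z hz m hm
    have hd := differentiableAt_of_contDiffOn hgI.isOpen hh (hmem z hz)
    rw [pderiv_congr hU hf hz, pderiv_mul (h := fun y => h (restrictTo b I y)) (hrd z hz)
      (hd.comp z (contDiff_restrictTo.differentiable (by simp) z)), hr0 z hz m hm,
      pderiv_comp_restrictTo hd m hm, zero_mul, zero_add]
  have hG : ∀ m (hm : b m = I), ∀ z ∈ U,
      g z m m = r z * leafMetric b I p g (restrictTo b I z) ⟨m, hm⟩ ⟨m, hm⟩ := by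
    intro m hm z hz
    rw [ha.metric_eq_warped hb hg hz hp hI ⟨m, hm⟩ ⟨m, hm⟩]
    simp only [hr]
    ring
  have hD : ∀ m (hm : b m = I) q (hq : b q = I), ∀ z ∈ U, pderiv q (fun y => g y m m) z
      = r z * pderiv ⟨q, hq⟩ (fun y => leafMetric b I p g y ⟨m, hm⟩ ⟨m, hm⟩) (restrictTo b I z) :=
    fun m hm q hq z hz => hscale _ _ (hgI.smooth ⟨m, hm⟩ ⟨m, hm⟩) (hG m hm) z hz q hq
  have h0 : ∀ m, g x m m ≠ 0 := ho.ne_zero hg hx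
  have key := hl _ (hmem x hx) ⟨i, hi⟩ ⟨j, hj⟩ ⟨l, hlI⟩ (by simpa using hij) (by simpa using hil)
    (by simpa using hjl)
  rw [hscale _ _ (contDiffOn_pderiv hgI.isOpen (hgI.smooth ⟨i, hi⟩ ⟨i, hi⟩) ⟨j, hj⟩)
    (hD i hi j hj) x hx l hlI, key]
  have h1 := h0 i
  have h2 := h0 j
  have h3 := h0 l
  rw [hG i hi x hx] at h1 ⊢
  rw [hG j hj x hx] at h2 ⊢
  rw [hG l hlI x hx] at h3 ⊢
  rw [hD i hi j hj x hx, hD i hi l hlI x hx, hD j hj l hlI x hx, hD l hlI j hj x hx]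
  have hrx : r x ≠ 0 := left_ne_zero_of_mul h1
  have h1' := right_ne_zero_of_mul h1
  have h2' := right_ne_zero_of_mul h2
  have h3' := right_ne_zero_of_mul h3
  field_simp

/-- The cases are distinguished by which of `j, l` share the eigenspace of `i`. If both do, the leaf
equation is rescaled. If exactly one does, its `α` vanishes and its eigenvalue is `λ_i`, so two of
the three terms on the right agree and the third is zero. If neither does, both sides are explicit
in `α` and `λ`. -/
theorem IsAdapted.satisfiesLame (ha : IsAdapted U g b lam α e)
    (hb : IsAssociatedProduct U g L b) (hg : IsMetricOn U g) {p : Fin (k + 1) → ι → ℝ}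
    (hp : ∀ I, p I ∈ U) (ho : IsOrthogonal U g)
    (hl : ∀ I, I ≠ 0 → SatisfiesLame (leafDomain b I (p I) U) (leafMetric b I (p I) g)) :
    SatisfiesLame U g := by
  intro x hx i j l hij hil hjl
  have h0 := ho.ne_zero hg hx
  have hi0 := h0 i
  have hj0 := h0 j
  have hl0 := h0 l
  by_cases hji : SameEigenspace b j i <;> by_cases hli : SameEigenspace b l i
  · obtain ⟨h1, h2⟩ := hji.resolve_left hij.symm
    obtain ⟨h3, -⟩ := hli.resolve_left hil.symm
    exact ha.satisfiesLame_of_sameEigenspace hb hg (hp (b i)) (h1 ▸ h2) ho (hl _ (h1 ▸ h2)) hx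
      rfl h1 h3 hij hil hjl
  · have hlj : ¬ SameEigenspace b l j := fun h => hli (h.trans hji)
    rw [pderiv_comm hg.isOpen (hg.smooth i i) hx,
      ha.pderiv_pderiv_diag hg hx hli hij.symm hjl, ha.pderiv_diag hx hli,
      ha.pderiv_diag hx hlj, ha.pderiv_diag hx fun h => hlj h.symm,
      ha.alpha_eq_zero x hx j (hji.ne_zero hij.symm), (ha.lam_eq_iff x hx j i).2 hji]
    field_simp
    ring
  · have hjl' : ¬ SameEigenspace b j l := fun h => hji (h.trans hli)
    rw [ha.pderiv_pderiv_diag hg hx hji hil.symm hjl.symm, ha.pderiv_diag hx hji,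
      ha.pderiv_diag hx hjl', ha.pderiv_diag hx fun h => hjl' h.symm,
      ha.alpha_eq_zero x hx l (hli.ne_zero hil.symm), (ha.lam_eq_iff x hx l i).2 hli]
    field_simp
    ring
  · rw [ha.pderiv_pderiv_diag hg hx hji hil.symm hjl.symm, ha.pderiv_diag hx hji,
      ha.pderiv_diag hx hli]
    by_cases hjl' : SameEigenspace b j l
    · rw [ha.alpha_eq_zero x hx j (hjl'.ne_zero hjl),
        ha.alpha_eq_zero x hx l (hjl'.symm.ne_zero hjl.symm)]
      simp
    · rw [ha.pderiv_diag hx hjl', ha.pderiv_diag hx fun h => hjl' h.symm]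
      -- What remains is the partial fraction identity `1/((λ_j-λ_i)(λ_l-λ_i)) = (1/(λ_l-λ_j))
      -- (1/(λ_j-λ_i) - 1/(λ_l-λ_i))`.
      have n1 := ha.lam_ne hx hji
      have n2 := ha.lam_ne hx hli
      have n3 := ha.lam_ne hx hjl'
      have n4 := ha.lam_ne hx fun h => hjl' (SameEigenspace.symm h)
      field_simp
      ring

end Leaves

/-! ### Complete integrals -/

section CompleteIntegral

variable {ι : Type} [Fintype ι] [DecidableEq ι] {V C : Set (ι → ℝ)} {g : (ι → ℝ) → Matrix ι ι ℝ}
  {S : (ι → ℝ) → (ι → ℝ) → ℝ} {E : (ι → ℝ) → ℝ}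

theorem contDiffOn_pderiv_left (hV : IsOpen V) (hC : IsOpen C)
    (hS : ContDiffOn ℝ ∞ (fun q : (ι → ℝ) × (ι → ℝ) => S q.1 q.2) (V ×ˢ C)) (i : ι) :
    ContDiffOn ℝ ∞ (fun q : (ι → ℝ) × (ι → ℝ) => pderiv i (fun y => S y q.2) q.1) (V ×ˢ C) := by
  have hVC := hV.prod hC
  have h : ContDiffOn ℝ ∞ (fun q : (ι → ℝ) × (ι → ℝ) =>
      fderiv ℝ (fun q : (ι → ℝ) × (ι → ℝ) => S q.1 q.2) q (Pi.single i 1, 0)) (V ×ˢ C) :=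
    (hS.fderiv_of_isOpen hVC (m := ∞) (by simp)).clm_apply contDiffOn_const
  refine h.congr fun q hq => ?_
  have hd : DifferentiableAt ℝ (fun q : (ι → ℝ) × (ι → ℝ) => S q.1 q.2) (q.1, q.2) :=
    (hS.contDiffAt (hVC.mem_nhds hq)).differentiableAt (by simp)
  have hin : HasFDerivAt (fun y : ι → ℝ => (y, q.2)) (ContinuousLinearMap.inl ℝ _ _) q.1 :=
    hasFDerivAt_prodMk_left q.1 q.2
  have := (hd.hasFDerivAt.comp q.1 hin).fderiv
  rw [pderiv, show (fun y => S y q.2) = (fun q : (ι → ℝ) × (ι → ℝ) => S q.1 q.2) ∘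
    (fun y : ι → ℝ => (y, q.2)) from rfl, this]
  simp

theorem contDiffOn_pderiv_parameter (hV : IsOpen V) (hC : IsOpen C)
    (hS : ContDiffOn ℝ ∞ (fun q : (ι → ℝ) × (ι → ℝ) => S q.1 q.2) (V ×ˢ C)) (i : ι)
    {x : ι → ℝ} (hx : x ∈ V) :
    ContDiffOn ℝ ∞ (fun c => pderiv i (fun y => S y c) x) C :=
  (contDiffOn_pderiv_left hV hC hS i).comp (contDiffOn_const.prodMk contDiffOn_id)
    fun _ hc => ⟨hx, hc⟩

theorem contDiffOn_slice_left {c : ι → ℝ} (hc : c ∈ C)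
    (hS : ContDiffOn ℝ ∞ (fun q : (ι → ℝ) × (ι → ℝ) => S q.1 q.2) (V ×ˢ C)) :
    ContDiffOn ℝ ∞ (fun y => S y c) V :=
  hS.comp (contDiffOn_id.prodMk contDiffOn_const) fun _ hy => ⟨hy, hc⟩

/-- The energy is not assumed smooth; the Hamilton-Jacobi equation at one fixed point expresses it
through the smooth momenta. -/
theorem IsCompleteIntegral.contDiffOn_energy (hV : IsOpen V) (hC : IsOpen C)
    (hS : IsCompleteIntegral V C g S E) (hne : V.Nonempty) : ContDiffOn ℝ ∞ E C := by
  obtain ⟨x, hx⟩ := hne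
  have h : ContDiffOn ℝ ∞ (fun c => (1 / 2) * ∑ i, ∑ j, (g x)⁻¹ i j *
      pderiv i (fun y => S y c) x * pderiv j (fun y => S y c) x) C :=
    contDiffOn_const.mul (ContDiffOn.sum fun i _ => ContDiffOn.sum fun j _ =>
      (contDiffOn_const.mul (contDiffOn_pderiv_parameter hV hC hS.smooth i hx)).mul
        (contDiffOn_pderiv_parameter hV hC hS.smooth j hx))
  exact h.congr fun c hc => (hS.eqn x hx c hc).symm

theorem sum_inv_mul_mul_of_offDiag_eq_zero {A : Matrix ι ι ℝ} (h : ∀ i j, i ≠ j → A i j = 0)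
    (hA : A.det ≠ 0) (v : ι → ℝ) :
    ∑ i, ∑ j, A⁻¹ i j * v i * v j = ∑ i, v i ^ 2 / A i i := by
  refine Finset.sum_congr rfl fun i _ => ?_
  rw [Finset.sum_eq_single i]
  · rw [inv_apply_of_offDiag_eq_zero h hA, if_pos rfl]
    ring
  · intro j _ hj
    rw [inv_apply_of_offDiag_eq_zero h hA, if_neg hj.symm]
    ring
  · simp

theorem pderiv_sqrt {f : (ι → ℝ) → ℝ} {x : ι → ℝ} {i : ι} (hf : DifferentiableAt ℝ f x)
    (h0 : f x ≠ 0) :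
    pderiv i (fun y => √(f y)) x = pderiv i f x / (2 * √(f x)) := by
  rw [pderiv, (hf.hasFDerivAt.sqrt h0).fderiv]
  simp only [FunLike.coe_smul, Pi.smul_apply, smul_eq_mul, pderiv]
  ring

theorem pderiv_coord (i j : ι) (x : ι → ℝ) :
    pderiv i (fun y => y j) x = if j = i then 1 else 0 := by
  rw [pderiv, (hasFDerivAt_apply (𝕜 := ℝ) j x).fderiv]
  simp [Pi.single_apply]

theorem pderiv_sum_separated {w : ι → ℝ → ℝ} {w' : ι → ℝ} {x : ι → ℝ}
    (hw : ∀ i, HasDerivAt (w i) (w' i) (x i)) (i : ι) :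
    pderiv i (fun y => ∑ j, w j (y j)) x = w' i := by
  have hd : ∀ j, HasFDerivAt (fun y : ι → ℝ => w j (y j))
      (w' j • ContinuousLinearMap.proj (R := ℝ) (φ := fun _ : ι => ℝ) j) x := fun j =>
    (hw j).comp_hasFDerivAt x (hasFDerivAt_apply (𝕜 := ℝ) j x)
  rw [pderiv_sum _ fun j _ => (hd j).differentiableAt]
  simp only [pderiv, (hd _).fderiv]
  simp [Pi.single_apply]

end CompleteIntegral

/-! ### Identities from Lagrange interpolation -/

section Lagrange

variable {ι : Type} [DecidableEq ι] {A : Finset ι} {v : ι → ℝ}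

/-- The numerator is a monic polynomial of degree `|A| - 1` evaluated at the nodes, and the sum is
the Lagrange formula for its top coefficient. -/
theorem sum_prod_sub_div_prod_sub (hv : Set.InjOn v A) (w : ι → ℝ) {j : ι} (hj : j ∈ A) :
    ∑ a ∈ A, (∏ m ∈ A.erase j, (v a - w m)) / ∏ m ∈ A.erase a, (v a - v m) = 1 := by
  have hcard : (A.erase j).card = A.card - 1 := Finset.card_erase_of_mem hj
  have hpos : 0 < A.card := Finset.card_pos.2 ⟨j, hj⟩
  have h := Lagrange.coeff_eq_sum hv (P := Lagrange.nodal (A.erase j) w) (by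
    rw [Lagrange.degree_nodal, hcard]
    exact_mod_cast Nat.sub_lt hpos one_pos)
  simp only [Lagrange.eval_nodal] at h
  rw [← h, ← hcard, ← Lagrange.natDegree_nodal (s := A.erase j) (v := w)]
  exact Lagrange.nodal_monic.coeff_natDegree

/-- The Lagrange basis polynomials sum to `1`; evaluate at `s` and divide by `∏ (s - v_a)`. Without
nodes the left side is `0` while the empty product gives `1`, hence the correction, which later
accounts for products without a factor `M_0`. -/
theorem sum_one_div_mul_prod_sub (hv : Set.InjOn v A) {s : ℝ} (hs : ∀ a ∈ A, s - v a ≠ 0) :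
    ∑ a ∈ A, 1 / (s - v a) / ∏ m ∈ A.erase a, (v a - v m)
      = 1 / ∏ a ∈ A, (s - v a) - if A.Nonempty then 0 else 1 := by
  split_ifs with hA
  · have h := congrArg (Polynomial.eval s) (Lagrange.sum_basis hv hA)
    simp only [Polynomial.eval_finsetSum, Lagrange.basis, Polynomial.eval_prod,
      Lagrange.basisDivisor, Polynomial.eval_mul, Polynomial.eval_C, Polynomial.eval_sub,
      Polynomial.eval_X, Polynomial.eval_one, Finset.prod_mul_distrib] at h
    rw [sub_zero, eq_div_iff (Finset.prod_ne_zero_iff.2 hs), Finset.sum_mul]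
    refine Eq.trans ?_ h
    refine Finset.sum_congr rfl fun a ha => ?_
    rw [← Finset.mul_prod_erase A _ ha, Finset.prod_inv_distrib]
    have := hs a ha
    field_simp
  · rw [Finset.not_nonempty_iff_eq_empty] at hA
    simp [hA]

end Lagrange

/-! ### Separated momenta -/

section Momentum

variable {ι κ : Type} [Fintype ι] [DecidableEq ι] {A : Finset ι} {N : Finset κ} {w : ι → ℝ}
  {e : κ → ℝ} {φ l : ℝ → ℝ} {H : κ → (ι → ℝ) → ℝ}

/-- The square of the momentum in the separated Hamilton-Jacobi equation, for a coordinate `t` with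
eigenvalue `l t`; here `H I c` are the values of the Hamiltonians of the factors. -/
noncomputable def momentumSq (A : Finset ι) (N : Finset κ) (w : ι → ℝ) (e : κ → ℝ) (φ l : ℝ → ℝ)
    (H : κ → (ι → ℝ) → ℝ) (t : ℝ) (c : ι → ℝ) : ℝ :=
  φ t * (∑ j ∈ A, c j * ∏ m ∈ A.erase j, (l t - w m) - ∑ I ∈ N, H I c / (e I - l t))

theorem contDiffOn_momentumSq {T : Set ℝ} {C : Set (ι → ℝ)} (hφ : ContDiffOn ℝ ∞ φ T)
    (hl : ContDiffOn ℝ ∞ l T) (hH : ∀ I ∈ N, ContDiffOn ℝ ∞ (H I) C)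
    (he : ∀ t ∈ T, ∀ I ∈ N, e I - l t ≠ 0) :
    ContDiffOn ℝ ∞ (fun q : ℝ × (ι → ℝ) => momentumSq A N w e φ l H q.1 q.2) (T ×ˢ C) := by
  have hφ' : ContDiffOn ℝ ∞ (fun q : ℝ × (ι → ℝ) => φ q.1) (T ×ˢ C) :=
    hφ.comp contDiffOn_fst fun q hq => hq.1
  have hl' : ContDiffOn ℝ ∞ (fun q : ℝ × (ι → ℝ) => l q.1) (T ×ˢ C) :=
    hl.comp contDiffOn_fst fun q hq => hq.1
  have hH' : ∀ I ∈ N, ContDiffOn ℝ ∞ (fun q : ℝ × (ι → ℝ) => H I q.2) (T ×ˢ C) := fun I hI =>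
    (hH I hI).comp contDiffOn_snd fun q hq => hq.2
  have hc : ∀ j, ContDiffOn ℝ ∞ (fun q : ℝ × (ι → ℝ) => q.2 j) (T ×ˢ C) := fun j =>
    ContDiff.contDiffOn (by fun_prop)
  refine hφ'.mul (ContDiffOn.sub (ContDiffOn.sum fun j _ => (hc j).mul
    (contDiffOn_prod fun m _ => hl'.sub contDiffOn_const)) (ContDiffOn.sum fun I hI =>
      (hH' I hI).div (contDiffOn_const.sub hl') fun q hq => he q.1 hq.1 I hI))

theorem pderiv_momentumSq {t : ℝ} {c : ι → ℝ} {j : ι} (hj : j ∈ A)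
    (hH : ∀ I ∈ N, DifferentiableAt ℝ (H I) c) (hHj : ∀ I ∈ N, pderiv j (H I) c = 0) :
    pderiv j (momentumSq A N w e φ l H t) c = φ t * ∏ m ∈ A.erase j, (l t - w m) := by
  have h1 : ∀ i ∈ A, DifferentiableAt ℝ
      (fun c : ι → ℝ => c i * ∏ m ∈ A.erase i, (l t - w m)) c := fun i _ => by fun_prop
  have h2 : ∀ I ∈ N, DifferentiableAt ℝ (fun c : ι → ℝ => H I c / (e I - l t)) c :=
    fun I hI => by simpa only [div_eq_mul_inv] using (hH I hI).mul_const _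
  have h2' : ∀ I ∈ N, pderiv j (fun c : ι → ℝ => H I c / (e I - l t)) c = 0 := fun I hI => by
    simp only [div_eq_inv_mul]
    rw [pderiv_const_mul _ (hH I hI), hHj I hI, mul_zero]
  have h1' : ∀ i ∈ A, pderiv j (fun c : ι → ℝ => c i * ∏ m ∈ A.erase i, (l t - w m)) c
      = if i = j then ∏ m ∈ A.erase i, (l t - w m) else 0 := fun i _ => by
    simp only [mul_comm (_ : ℝ) (∏ m ∈ A.erase i, (l t - w m))]
    rw [pderiv_const_mul _ (by fun_prop), pderiv_coord]
    simp
  have hs1 := DifferentiableAt.fun_sum h1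
  have hs2 := DifferentiableAt.fun_sum h2
  change pderiv j (fun c => φ t * (∑ j ∈ A, c j * ∏ m ∈ A.erase j, (l t - w m)
    - ∑ I ∈ N, H I c / (e I - l t))) c = _
  rw [pderiv_const_mul _ (hs1.fun_sub hs2), pderiv_sub hs1 hs2, pderiv_sum _ h1, pderiv_sum _ h2,
    Finset.sum_congr rfl h1', Finset.sum_congr rfl h2']
  simp [hj]

/-- The denominators are the metric coefficients of `M_0`, so this is the contribution of `M_0` to
twice the Hamiltonian: a constant minus the terms that will cancel the warped factor Hamiltonians.
-/
theorem sum_momentumSq_div {ψ : ι → ℝ → ℝ} {m : ι → ℝ → ℝ} {x c : ι → ℝ}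
    (hinj : Set.InjOn (fun a => m a (x a)) A) (hψ : ∀ a ∈ A, ψ a (x a) ≠ 0)
    (he : ∀ I ∈ N, ∀ a ∈ A, e I - m a (x a) ≠ 0) :
    ∑ a ∈ A, momentumSq A N w e (ψ a) (m a) H (x a) c
        / (ψ a (x a) * ∏ r ∈ A.erase a, (m a (x a) - m r (x r)))
      = ∑ j ∈ A, c j - ∑ I ∈ N, H I c *
        (1 / ∏ a ∈ A, (e I - m a (x a)) - if A.Nonempty then 0 else 1) := by
  have h1 : ∀ a ∈ A, momentumSq A N w e (ψ a) (m a) H (x a) c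
        / (ψ a (x a) * ∏ r ∈ A.erase a, (m a (x a) - m r (x r)))
      = ∑ j ∈ A, c j * ((∏ r ∈ A.erase j, (m a (x a) - w r))
          / ∏ r ∈ A.erase a, (m a (x a) - m r (x r)))
        - ∑ I ∈ N, H I c * (1 / (e I - m a (x a))
          / ∏ r ∈ A.erase a, (m a (x a) - m r (x r))) := by
    intro a ha
    rw [momentumSq, mul_div_mul_left _ _ (hψ a ha), sub_div, Finset.sum_div, Finset.sum_div]
    congr 1
    · exact Finset.sum_congr rfl fun j _ => by rw [mul_div_assoc]
    · exact Finset.sum_congr rfl fun I _ => by rw [← mul_div_assoc, mul_one_div]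
  rw [Finset.sum_congr rfl h1, Finset.sum_sub_distrib, Finset.sum_comm,
    Finset.sum_comm (s := A) (t := N)]
  congr 1
  · refine Finset.sum_congr rfl fun j hj => ?_
    rw [← Finset.mul_sum, sum_prod_sub_div_prod_sub hinj w hj, mul_one]
  · refine Finset.sum_congr rfl fun I hI => ?_
    rw [← Finset.mul_sum, sum_one_div_mul_prod_sub hinj (he I hI)]

end Momentum

/-! ### Complete integrals on a warped product -/

/-- The coordinates that belong to `M_0`. -/
def simpleIndices {ι : Type} [Fintype ι] {k : ℕ} (b : ι → Fin (k + 1)) : Finset ι :=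
  Finset.univ.filter fun a => b a = 0

theorem mem_simpleIndices {ι : Type} [Fintype ι] {k : ℕ} {b : ι → Fin (k + 1)} {a : ι} :
    a ∈ simpleIndices b ↔ b a = 0 := by
  simp [simpleIndices]

/-- The value of the Hamiltonian of the `I`-th factor, up to the normalization `r` of the warping
function. -/
def factorEnergy {ι : Type} {k : ℕ} (b : ι → Fin (k + 1)) (r : Fin (k + 1) → ℝ)
    (Ef : ∀ I, ({j // b j = I} → ℝ) → ℝ) (I : Fin (k + 1)) (c : ι → ℝ) : ℝ :=
  2 * r I * Ef I fun j => c j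

/-- A metric which is, near `x₀`, a warped product in which `M_0` is separated, together with
complete integrals on the factors and with parameters near `c₀` for which the separated
momenta on `M_0` are real. -/
structure SeparationDatum {ι : Type} [Fintype ι] [DecidableEq ι] (g : (ι → ℝ) → Matrix ι ι ℝ)
    {k : ℕ} (b : ι → Fin (k + 1)) where
  x₀ : ι → ℝ
  c₀ : ι → ℝ
  δ : ℝ
  m : ι → ℝ → ℝ
  ψ : ι → ℝ → ℝ
  w : ι → ℝ
  e : Fin (k + 1) → ℝ
  r : Fin (k + 1) → ℝ
  γ : ∀ I, ({j // b j = I} → ℝ) → Matrix {j // b j = I} {j // b j = I} ℝ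
  Vf : ∀ I, Set ({j // b j = I} → ℝ)
  Cf : ∀ I, Set ({j // b j = I} → ℝ)
  Wf : ∀ I, {j // b j = I} → ℝ → ({j // b j = I} → ℝ) → ℝ
  Ef : ∀ I, ({j // b j = I} → ℝ) → ℝ
  pos : 0 < δ
  isOpen_V : ∀ I, I ≠ 0 → IsOpen (Vf I)
  isOpen_C : ∀ I, I ≠ 0 → IsOpen (Cf I)
  integral : ∀ I, I ≠ 0 → IsCompleteIntegral (Vf I) (Cf I) (γ I)
    (fun y c => ∑ j, Wf I j (y j) c) (Ef I)
  mem_V : ∀ x ∈ Metric.ball x₀ δ, ∀ I, I ≠ 0 → restrictTo b I x ∈ Vf I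
  mem_C : ∀ c ∈ Metric.ball c₀ δ, ∀ I, I ≠ 0 → restrictTo b I c ∈ Cf I
  m_smooth : ∀ a, b a = 0 → ContDiffOn ℝ ∞ (m a) (Metric.ball (x₀ a) δ)
  ψ_smooth : ∀ a, b a = 0 → ContDiffOn ℝ ∞ (ψ a) (Metric.ball (x₀ a) δ)
  momentum_pos : ∀ a, b a = 0 → ∀ t ∈ Metric.ball (x₀ a) δ, ∀ c ∈ Metric.ball c₀ δ,
    0 < momentumSq (simpleIndices b) (Finset.univ.erase 0) w e (ψ a) (m a)
      (factorEnergy b r Ef) t c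
  ψ_ne : ∀ a, b a = 0 → ∀ t ∈ Metric.ball (x₀ a) δ, ψ a t ≠ 0
  sub_ne : ∀ I, I ≠ 0 → ∀ a, b a = 0 → ∀ t ∈ Metric.ball (x₀ a) δ, e I - m a t ≠ 0
  injOn : ∀ x ∈ Metric.ball x₀ δ, Set.InjOn (fun a => m a (x a)) (simpleIndices b)
  metric_simple : ∀ x ∈ Metric.ball x₀ δ, ∀ a, b a = 0 →
    g x a a = ψ a (x a) * ∏ q ∈ (simpleIndices b).erase a, (m a (x a) - m q (x q))
  metric_factor : ∀ x ∈ Metric.ball x₀ δ, ∀ I, I ≠ 0 → ∀ j : {j // b j = I},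
    g x j j = (∏ a ∈ simpleIndices b, (e I - m a (x a))) / r I * γ I (restrictTo b I x) j j
  r_ne : ∀ I, I ≠ 0 → r I ≠ 0
  orthogonal : ∀ x ∈ Metric.ball x₀ δ, ∀ i j, i ≠ j → g x i j = 0
  det_ne : ∀ x ∈ Metric.ball x₀ δ, (g x).det ≠ 0
  factor_orthogonal : ∀ I, I ≠ 0 → ∀ y ∈ Vf I, ∀ i j, i ≠ j → γ I y i j = 0
  factor_det_ne : ∀ I, I ≠ 0 → ∀ y ∈ Vf I, (γ I y).det ≠ 0
  stackel_det_ne : ∀ x ∈ Metric.ball x₀ δ, (Matrix.of fun a j : {a // b a = 0} =>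
    ∏ q ∈ (simpleIndices b).erase j, (m a (x a) - w q)).det ≠ 0

namespace SeparationDatum

variable {ι : Type} [Fintype ι] [DecidableEq ι] {g : (ι → ℝ) → Matrix ι ι ℝ} {k : ℕ}
  {b : ι → Fin (k + 1)} (D : SeparationDatum g b) {x c : ι → ℝ}

/-- The Hamiltonians of the factors as functions of the parameters. -/
def H : Fin (k + 1) → (ι → ℝ) → ℝ := factorEnergy b D.r D.Ef

/-- The squared momentum of a coordinate of `M_0`. -/
noncomputable def Q (a : ι) (t : ℝ) (c : ι → ℝ) : ℝ :=
  momentumSq (simpleIndices b) (Finset.univ.erase 0) D.w D.e (D.ψ a) (D.m a) D.H t c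

/-- The separated summands of the complete integral. -/
noncomputable def W (i : ι) (t : ℝ) (c : ι → ℝ) : ℝ :=
  if b i = 0 then ∫ s in D.x₀ i..t, √(D.Q i s c)
  else D.Wf (b i) ⟨i, rfl⟩ t (restrictTo b (b i) c)

/-- The energy as a function of the parameters. -/
noncomputable def E (c : ι → ℝ) : ℝ :=
  (1 / 2) * (∑ j ∈ simpleIndices b, c j
    + (if (simpleIndices b).Nonempty then 0 else 1) * ∑ I ∈ Finset.univ.erase 0, D.H I c)

theorem W_factor {I : Fin (k + 1)} (hI : I ≠ 0) (j : {j // b j = I}) (t : ℝ) (c : ι → ℝ) :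
    D.W j t c = D.Wf I j t (restrictTo b I c) := by
  obtain ⟨j, rfl⟩ := j
  simp [W, hI]

theorem W_simple {a : ι} (ha : b a = 0) (t : ℝ) (c : ι → ℝ) :
    D.W a t c = ∫ s in D.x₀ a..t, √(D.Q a s c) := by
  simp [W, ha]

theorem apply_mem_ball (hx : x ∈ Metric.ball D.x₀ D.δ) (a : ι) :
    x a ∈ Metric.ball (D.x₀ a) D.δ :=
  (dist_le_pi_dist x D.x₀ a).trans_lt hx

theorem contDiffOn_Ef {I : Fin (k + 1)} (hI : I ≠ 0) : ContDiffOn ℝ ∞ (D.Ef I) (D.Cf I) :=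
  (D.integral I hI).contDiffOn_energy (D.isOpen_V I hI) (D.isOpen_C I hI)
    ⟨_, D.mem_V D.x₀ (Metric.mem_ball_self D.pos) I hI⟩

theorem contDiffOn_H {I : Fin (k + 1)} (hI : I ≠ 0) :
    ContDiffOn ℝ ∞ (D.H I) (Metric.ball D.c₀ D.δ) :=
  contDiffOn_const.mul ((D.contDiffOn_Ef hI).comp contDiff_restrictTo.contDiffOn
    fun c hc => D.mem_C c hc I hI)

theorem contDiffOn_Q {a : ι} (ha : b a = 0) :
    ContDiffOn ℝ ∞ (fun q : ℝ × (ι → ℝ) => D.Q a q.1 q.2)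
      (Metric.ball (D.x₀ a) D.δ ×ˢ Metric.ball D.c₀ D.δ) :=
  contDiffOn_momentumSq (D.ψ_smooth a ha) (D.m_smooth a ha)
    (fun _ hI => D.contDiffOn_H (Finset.ne_of_mem_erase hI))
    fun t ht I hI => D.sub_ne I (Finset.ne_of_mem_erase hI) a ha t ht

theorem Q_pos {a : ι} (ha : b a = 0) {t : ℝ} (ht : t ∈ Metric.ball (D.x₀ a) D.δ)
    (hc : c ∈ Metric.ball D.c₀ D.δ) : 0 < D.Q a t c :=
  D.momentum_pos a ha t ht c hc

theorem contDiffOn_sqrt_Q {a : ι} (ha : b a = 0) :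
    ContDiffOn ℝ ∞ (fun q : ℝ × (ι → ℝ) => √(D.Q a q.1 q.2))
      (Metric.ball (D.x₀ a) D.δ ×ˢ Metric.ball D.c₀ D.δ) :=
  (D.contDiffOn_Q ha).sqrt fun _ hq => (D.Q_pos ha hq.1 hq.2).ne'

theorem hasDerivAt_W {a : ι} (ha : b a = 0) {t : ℝ} (ht : t ∈ Metric.ball (D.x₀ a) D.δ)
    (hc : c ∈ Metric.ball D.c₀ D.δ) : HasDerivAt (fun t => D.W a t c) (√(D.Q a t c)) t := by
  simp only [D.W_simple ha]
  exact hasDerivAt_parametric_primitive ((D.contDiffOn_sqrt_Q ha).continuousOn.comp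
    (f := fun s => (s, c)) (by fun_prop) fun s hs => ⟨hs, hc⟩) ht

/-- The part of the complete integral that belongs to the `I`-th factor. -/
noncomputable def part (I : Fin (k + 1)) (y : {j // b j = I} → ℝ) (c : ι → ℝ) : ℝ :=
  ∑ j : {j // b j = I}, D.W j (y j) c

theorem sum_eq_sum_fiber (F : ι → ℝ) : ∑ i, F i = ∑ I, ∑ j : {j // b j = I}, F j :=
  (Fintype.sum_fiberwise b F).symm

theorem sum_W_eq (x c : ι → ℝ) :
    ∑ i, D.W i (x i) c = ∑ I, D.part I (restrictTo b I x) c :=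
  sum_eq_sum_fiber _

theorem part_factor {I : Fin (k + 1)} (hI : I ≠ 0) (y : {j // b j = I} → ℝ) (c : ι → ℝ) :
    D.part I y c = ∑ j, D.Wf I j (y j) (restrictTo b I c) :=
  Finset.sum_congr rfl fun j _ => D.W_factor hI j _ _

theorem contDiffOn_part (I : Fin (k + 1)) :
    ContDiffOn ℝ ∞ (fun q : (ι → ℝ) × (ι → ℝ) => D.part I (restrictTo b I q.1) q.2)
      (Metric.ball D.x₀ D.δ ×ˢ Metric.ball D.c₀ D.δ) := by
  by_cases hI : I = 0
  · subst hI
    refine ContDiffOn.sum fun j _ => ?_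
    simp only [D.W_simple j.2]
    refine (contDiffOn_parametric_primitive Metric.isOpen_ball (D.contDiffOn_sqrt_Q j.2)).comp
      (f := fun q : (ι → ℝ) × (ι → ℝ) => (q.1 j.1, q.2)) (ContDiff.contDiffOn (by fun_prop))
      fun q hq => ⟨D.apply_mem_ball hq.1 j, hq.2⟩
  · simp only [D.part_factor hI]
    exact (D.integral I hI).smooth.comp (f := fun q : (ι → ℝ) × (ι → ℝ) =>
      (restrictTo b I q.1, restrictTo b I q.2))
      (((contDiff_restrictTo.comp contDiff_fst).prodMk
        (contDiff_restrictTo.comp contDiff_snd)).contDiffOn)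
      fun q hq => ⟨D.mem_V _ hq.1 I hI, D.mem_C _ hq.2 I hI⟩

theorem differentiableAt_part (I : Fin (k + 1)) (hx : x ∈ Metric.ball D.x₀ D.δ)
    (hc : c ∈ Metric.ball D.c₀ D.δ) :
    DifferentiableAt ℝ (fun y => D.part I y c) (restrictTo b I x) := by
  by_cases hI : I = 0
  · subst hI
    refine DifferentiableAt.fun_sum fun j _ => ?_
    exact ((D.hasDerivAt_W j.2 (D.apply_mem_ball hx j) hc).differentiableAt).comp
      (f := fun y : {j // b j = 0} → ℝ => y j) (restrictTo b 0 x) (differentiableAt_apply j _)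
  · simp only [D.part_factor hI]
    exact differentiableAt_of_contDiffOn (D.isOpen_V I hI)
      (contDiffOn_slice_left (S := fun y c => ∑ j, D.Wf I j (y j) c) (D.mem_C c hc I hI)
        (D.integral I hI).smooth) (D.mem_V x hx I hI)

theorem pderiv_sum_W (hx : x ∈ Metric.ball D.x₀ D.δ) (hc : c ∈ Metric.ball D.c₀ D.δ)
    {I : Fin (k + 1)} {i : ι} (hi : b i = I) :
    pderiv i (fun x => ∑ i, D.W i (x i) c) x
      = pderiv ⟨i, hi⟩ (fun y => D.part I y c) (restrictTo b I x) := by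
  simp only [D.sum_W_eq]
  rw [pderiv_sum (F := fun J x => D.part J (restrictTo b J x) c) _ fun J _ => (D.differentiableAt_part J hx hc).comp x
    (contDiff_restrictTo.differentiable (by simp) x), Finset.sum_eq_single I]
  · exact pderiv_comp_restrictTo (D.differentiableAt_part I hx hc) i hi
  · intro J _ hJ
    exact pderiv_comp_restrictTo_of_ne (D.differentiableAt_part J hx hc) i
      fun h => hJ (h.symm.trans hi)
  · simp

theorem pderiv_sum_W_simple (hx : x ∈ Metric.ball D.x₀ D.δ) (hc : c ∈ Metric.ball D.c₀ D.δ)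
    {a : ι} (ha : b a = 0) :
    pderiv a (fun x => ∑ i, D.W i (x i) c) x = √(D.Q a (x a) c) := by
  rw [D.pderiv_sum_W hx hc ha]
  exact pderiv_sum_separated (ι := {j // b j = 0}) (w := fun j t => D.W j t c) (x := restrictTo b 0 x)
    (w' := fun j => √(D.Q j (x j) c))
    (fun j => D.hasDerivAt_W j.2 (D.apply_mem_ball hx j) hc) ⟨a, ha⟩

theorem pderiv_sum_W_factor (hx : x ∈ Metric.ball D.x₀ D.δ) (hc : c ∈ Metric.ball D.c₀ D.δ)
    {I : Fin (k + 1)} (hI : I ≠ 0) {i : ι} (hi : b i = I) :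
    pderiv i (fun x => ∑ i, D.W i (x i) c) x
      = pderiv ⟨i, hi⟩ (fun y => ∑ j, D.Wf I j (y j) (restrictTo b I c)) (restrictTo b I x) := by
  rw [D.pderiv_sum_W hx hc hi]
  simp only [D.part_factor hI]

/-- The leaf Hamilton-Jacobi equation is divided by the warping factor; the constant `r_I` in the
definition of `H_I` absorbs its normalization. -/
theorem sum_sq_factor (hx : x ∈ Metric.ball D.x₀ D.δ) (hc : c ∈ Metric.ball D.c₀ D.δ)
    {I : Fin (k + 1)} (hI : I ≠ 0) :
    ∑ j : {j // b j = I}, pderiv j.1 (fun x => ∑ i, D.W i (x i) c) x ^ 2 / g x j j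
      = D.H I c * (1 / ∏ a ∈ simpleIndices b, (D.e I - D.m a (x a))) := by
  have hV := D.mem_V x hx I hI
  have h := (D.integral I hI).eqn _ hV _ (D.mem_C c hc I hI)
  rw [sum_inv_mul_mul_of_offDiag_eq_zero (D.factor_orthogonal I hI _ hV)
    (D.factor_det_ne I hI _ hV)] at h
  have hr := D.r_ne I hI
  have hP : ∏ a ∈ simpleIndices b, (D.e I - D.m a (x a)) ≠ 0 := Finset.prod_ne_zero_iff.2
    fun a ha => D.sub_ne I hI a (mem_simpleIndices.1 ha) _ (D.apply_mem_ball hx a)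
  have hH : D.H I c = 2 * D.r I * D.Ef I (restrictTo b I c) := rfl
  rw [hH, ← h, ← mul_assoc, mul_right_comm, Finset.mul_sum]
  refine Finset.sum_congr rfl fun j _ => ?_
  rw [D.pderiv_sum_W_factor hx hc hI j.2, D.metric_factor x hx I hI j]
  have hγ := diag_ne_zero_of_offDiag_eq_zero (D.factor_orthogonal I hI _ hV)
    (D.factor_det_ne I hI _ hV) j
  field_simp

/-- The Hamiltonian is summed factor by factor. The contributions `H_I / ∏_a (e_I - λ_a)` cancel
against those in the squared momenta of `M_0`, and survive as `H_I` only when `M_0` has no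
coordinates. -/
theorem eqn (hx : x ∈ Metric.ball D.x₀ D.δ) (hc : c ∈ Metric.ball D.c₀ D.δ) :
    (1 / 2) * ∑ i, ∑ j, (g x)⁻¹ i j * pderiv i (fun x => ∑ i, D.W i (x i) c) x
      * pderiv j (fun x => ∑ i, D.W i (x i) c) x = D.E c := by
  rw [sum_inv_mul_mul_of_offDiag_eq_zero (D.orthogonal x hx) (D.det_ne x hx),
    sum_eq_sum_fiber (b := b), ← Finset.add_sum_erase _ _ (Finset.mem_univ (0 : Fin (k + 1))),
    Finset.sum_congr (g := fun I => D.H I c * (1 / ∏ a ∈ simpleIndices b, (D.e I - D.m a (x a))))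
      rfl fun I hI => D.sum_sq_factor hx hc (Finset.ne_of_mem_erase hI)]
  have h0 : ∑ j : {j // b j = 0}, pderiv j.1 (fun x => ∑ i, D.W i (x i) c) x ^ 2 / g x j j
      = ∑ a ∈ simpleIndices b, D.Q a (x a) c / (D.ψ a (x a) *
        ∏ q ∈ (simpleIndices b).erase a, (D.m a (x a) - D.m q (x q))) := by
    rw [Finset.sum_subtype (simpleIndices b) (p := fun a => b a = 0)
      fun a => mem_simpleIndices]
    refine Finset.sum_congr rfl fun j _ => ?_
    rw [D.pderiv_sum_W_simple hx hc j.2, D.metric_simple x hx j j.2,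
      Real.sq_sqrt (D.Q_pos j.2 (D.apply_mem_ball hx j) hc).le]
  have h1 := sum_momentumSq_div (A := simpleIndices b) (N := Finset.univ.erase 0) (w := D.w)
    (e := D.e) (H := D.H) (ψ := D.ψ) (m := D.m) (x := x) (c := c) (D.injOn x hx)
    (fun a ha => D.ψ_ne a (mem_simpleIndices.1 ha) _ (D.apply_mem_ball hx a))
    (fun I hI a ha => D.sub_ne I (Finset.ne_of_mem_erase hI) a (mem_simpleIndices.1 ha) _
      (D.apply_mem_ball hx a))
  rw [h0]
  refine congrArg _ ((congrArg (· + _) h1).trans ?_)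
  simp only [mul_sub, Finset.sum_sub_distrib, Finset.mul_sum]
  simp only [← Finset.sum_mul, mul_comm (ite _ _ _ : ℝ)]
  ring

theorem mixed_factor (hx : x ∈ Metric.ball D.x₀ D.δ) (hc : c ∈ Metric.ball D.c₀ D.δ)
    {I : Fin (k + 1)} (hI : I ≠ 0) {i : ι} (hi : b i = I) {j : ι} (hj : b j = I) :
    pderiv j (fun c => pderiv i (fun x => ∑ i, D.W i (x i) c) x) c
      = pderiv ⟨j, hj⟩ (fun c' => pderiv ⟨i, hi⟩ (fun y => ∑ j, D.Wf I j (y j) c')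
        (restrictTo b I x)) (restrictTo b I c) := by
  rw [pderiv_congr Metric.isOpen_ball (fun c' hc' => D.pderiv_sum_W_factor hx hc' hI hi) hc]
  refine pderiv_comp_restrictTo (h := fun c' => pderiv ⟨i, hi⟩ (fun y => ∑ j, D.Wf I j (y j) c')
        (restrictTo b I x)) ?_ j hj
  exact differentiableAt_of_contDiffOn (D.isOpen_C I hI) (contDiffOn_pderiv_parameter
    (S := fun y c => ∑ j, D.Wf I j (y j) c) (D.isOpen_V I hI) (D.isOpen_C I hI)
    (D.integral I hI).smooth _ (D.mem_V x hx I hI)) (D.mem_C c hc I hI)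

theorem mixed_factor_of_ne (hx : x ∈ Metric.ball D.x₀ D.δ) (hc : c ∈ Metric.ball D.c₀ D.δ)
    {i j : ι} (hi : b i ≠ 0) (hj : b j ≠ b i) :
    pderiv j (fun c => pderiv i (fun x => ∑ i, D.W i (x i) c) x) c = 0 := by
  rw [pderiv_congr Metric.isOpen_ball (fun c' hc' => D.pderiv_sum_W_factor hx hc' hi rfl) hc]
  refine pderiv_comp_restrictTo_of_ne (h := fun c' => pderiv ⟨i, rfl⟩
    (fun y => ∑ j, D.Wf (b i) j (y j) c') (restrictTo b (b i) x)) ?_ j hj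
  exact differentiableAt_of_contDiffOn (D.isOpen_C _ hi) (contDiffOn_pderiv_parameter
    (S := fun y c => ∑ j, D.Wf (b i) j (y j) c) (D.isOpen_V _ hi) (D.isOpen_C _ hi)
    (D.integral _ hi).smooth _ (D.mem_V x hx _ hi)) (D.mem_C c hc _ hi)

/-- The factor energies do not involve the parameters of `M_0`, so differentiating the squared
momentum in such a parameter sees only the polynomial part. -/
theorem mixed_simple (hx : x ∈ Metric.ball D.x₀ D.δ) (hc : c ∈ Metric.ball D.c₀ D.δ)
    {a j : ι} (ha : b a = 0) (hj : b j = 0) :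
    pderiv j (fun c => pderiv a (fun x => ∑ i, D.W i (x i) c) x) c
      = D.ψ a (x a) / (2 * √(D.Q a (x a) c)) *
        ∏ q ∈ (simpleIndices b).erase j, (D.m a (x a) - D.w q) := by
  have hxa := D.apply_mem_ball hx a
  have hd : DifferentiableAt ℝ (D.Q a (x a)) c :=
    differentiableAt_of_contDiffOn Metric.isOpen_ball ((D.contDiffOn_Q ha).comp
      (f := fun c => (x a, c)) (contDiffOn_const.prodMk contDiffOn_id) fun c hc => ⟨hxa, hc⟩) hc
  have hH : ∀ I ∈ Finset.univ.erase (0 : Fin (k + 1)), pderiv j (D.H I) c = 0 := by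
    intro I hI
    have hI := Finset.ne_of_mem_erase hI
    have hE := differentiableAt_of_contDiffOn (D.isOpen_C I hI) (D.contDiffOn_Ef hI)
      (D.mem_C c hc I hI)
    change pderiv j (fun c => 2 * D.r I * D.Ef I (restrictTo b I c)) c = 0
    rw [pderiv_const_mul (f := fun c => D.Ef I (restrictTo b I c)) _ (hE.comp c
      (contDiff_restrictTo.differentiable (by simp) c)),
      pderiv_comp_restrictTo_of_ne hE j (by rw [hj]; exact hI.symm), mul_zero]
  rw [pderiv_congr Metric.isOpen_ball (fun c' hc' => D.pderiv_sum_W_simple hx hc' ha) hc,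
    pderiv_sqrt hd (D.Q_pos ha hxa hc).ne',
    show pderiv j (D.Q a (x a)) c = _ from pderiv_momentumSq (mem_simpleIndices.2 hj)
      (fun I hI => differentiableAt_of_contDiffOn Metric.isOpen_ball
        (D.contDiffOn_H (Finset.ne_of_mem_erase hI)) hc) hH]
  ring

/-- Momenta of a factor depend only on that factor's parameters, which makes the matrix block
triangular. Its `0`-block is an invertible diagonal matrix times the Stäckel matrix; the other
blocks are those of the factor integrals. -/
theorem complete (hx : x ∈ Metric.ball D.x₀ D.δ) (hc : c ∈ Metric.ball D.c₀ D.δ) :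
    (Matrix.of fun i j =>
      pderiv j (fun c => pderiv i (fun x => ∑ i, D.W i (x i) c) x) c).det ≠ 0 := by
  have hbt : (Matrix.of fun i j =>
      pderiv j (fun c => pderiv i (fun x => ∑ i, D.W i (x i) c) x) c).BlockTriangular b := by
    intro i j hij
    exact D.mixed_factor_of_ne hx hc (Fin.pos_iff_ne_zero.1 ((Fin.zero_le _).trans_lt hij)) hij.ne
  rw [hbt.det_fintype, Finset.prod_ne_zero_iff]
  intro I _
  by_cases hI : I = 0
  · subst hI
    have : Matrix.toSquareBlock (Matrix.of fun i j =>
        pderiv j (fun c => pderiv i (fun x => ∑ i, D.W i (x i) c) x) c) b 0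
        = Matrix.diagonal (fun a : {a // b a = 0} => D.ψ a (x a) / (2 * √(D.Q a (x a) c)))
          * Matrix.of fun a j : {a // b a = 0} =>
            ∏ q ∈ (simpleIndices b).erase j, (D.m a (x a) - D.w q) := by
      ext a j
      rw [Matrix.diagonal_mul]
      exact D.mixed_simple hx hc a.2 j.2
    rw [this, Matrix.det_mul, Matrix.det_diagonal]
    refine mul_ne_zero (Finset.prod_ne_zero_iff.2 fun a _ => ?_) (D.stackel_det_ne x hx)
    have hxa := D.apply_mem_ball hx a
    exact div_ne_zero (D.ψ_ne a a.2 _ hxa)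
      (mul_ne_zero two_ne_zero (Real.sqrt_pos.2 (D.Q_pos a.2 hxa hc)).ne')
  · have := (D.integral I hI).complete _ (D.mem_V x hx I hI) _ (D.mem_C c hc I hI)
    refine fun h0 => this (Eq.trans ?_ h0)
    congr 1
    ext i j
    exact (D.mixed_factor hx hc hI i.2 j.2).symm

theorem isCompleteIntegral : IsCompleteIntegral (Metric.ball D.x₀ D.δ) (Metric.ball D.c₀ D.δ) g
    (fun x c => ∑ i, D.W i (x i) c) D.E where
  smooth := by
    simp only [D.sum_W_eq]
    exact ContDiffOn.sum fun I _ => D.contDiffOn_part I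
  eqn _ hx _ hc := D.eqn hx hc
  complete _ hx _ hc := D.complete hx hc

end SeparationDatum

/-! ### Separated normal form of the metric of `M_0` near a point -/

section LocalForm

variable {ι : Type} [Fintype ι] [DecidableEq ι] {U : Set (ι → ℝ)} {g L : (ι → ℝ) → Matrix ι ι ℝ}
  {x x₀ : ι → ℝ} {k : ℕ} {b : ι → Fin (k + 1)} {lam α : (ι → ℝ) → ι → ℝ} {e : Fin (k + 1) → ℝ}
  {ε : ℝ}

theorem mix_mem_ball (P : ι → Prop) [DecidablePred P] {x y : ι → ℝ} (hx : x ∈ Metric.ball x₀ ε)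
    (hy : y ∈ Metric.ball x₀ ε) : (fun i => if P i then x i else y i) ∈ Metric.ball x₀ ε := by
  have hε : 0 < ε := dist_nonneg.trans_lt (Metric.mem_ball.1 hx)
  rw [Metric.mem_ball, dist_pi_lt_iff hε] at hx hy ⊢
  intro i
  by_cases h : P i
  · simpa [h] using hx i
  · simpa [h] using hy i

theorem update_mem_ball {a : ι} {t : ℝ} (ht : t ∈ Metric.ball (x₀ a) ε) :
    Function.update x₀ a t ∈ Metric.ball x₀ ε := by
  have hε : 0 < ε := dist_nonneg.trans_lt (Metric.mem_ball.1 ht)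
  rw [Metric.mem_ball, dist_pi_lt_iff hε]
  intro i
  by_cases h : i = a
  · subst h; simpa using ht
  · simpa [h] using hε

/-- A function on a ball (in the supremum norm) all of whose partial derivatives but one vanish
depends on one variable only. -/
theorem eq_update_of_pderiv_eq_zero {f : (ι → ℝ) → ℝ} {a : ι}
    (hf : ∀ x ∈ Metric.ball x₀ ε, DifferentiableAt ℝ f x)
    (h0 : ∀ x ∈ Metric.ball x₀ ε, ∀ i, i ≠ a → pderiv i f x = 0) (hx : x ∈ Metric.ball x₀ ε) :
    f x = f (Function.update x₀ a (x a)) := by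
  refine eq_of_pderiv_eq_zero Metric.isOpen_ball (convex_ball x₀ ε).isPreconnected
    (fun i => i ≠ a) (fun x hx y hy => mix_mem_ball _ hx hy) hf h0 hx
    (update_mem_ball ((dist_le_pi_dist x x₀ a).trans_lt hx)) fun i hi => ?_
  push Not at hi
  simp [hi]

/-- The product of the differences of the `a`-th and the other simple eigenvalues. -/
def eigenvalueProduct (b : ι → Fin (k + 1)) (lam : (ι → ℝ) → ι → ℝ) (a : ι) (x : ι → ℝ) : ℝ :=
  ∏ r ∈ (simpleIndices b).erase a, (lam x a - lam x r)

theorem not_sameEigenspace_of_simple {i a : ι} (ha : b a = 0) (hi : i ≠ a) :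
    ¬ SameEigenspace b i a := fun h => h.symm.ne_zero hi.symm ha

theorem IsAdapted.eigenvalueProduct_ne_zero (ha : IsAdapted U g b lam α e) (hx : x ∈ U) {a : ι}
    (ha0 : b a = 0) : eigenvalueProduct b lam a x ≠ 0 := by
  refine Finset.prod_ne_zero_iff.2 fun r hr => ha.lam_ne hx fun h => ?_
  exact not_sameEigenspace_of_simple ha0 (Finset.ne_of_mem_erase hr) h.symm

theorem IsAdapted.contDiffOn_eigenvalueProduct (ha : IsAdapted U g b lam α e) (a : ι) :
    ContDiffOn ℝ ∞ (eigenvalueProduct b lam a) U :=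
  contDiffOn_prod fun r _ => (ha.lam_smooth a).sub (ha.lam_smooth r)

theorem IsAdapted.pderiv_eigenvalueProduct (ha : IsAdapted U g b lam α e) (hg : IsMetricOn U g)
    (hx : x ∈ U) {a i : ι} (ha0 : b a = 0) (hi : i ≠ a) :
    pderiv i (eigenvalueProduct b lam a) x
      = α x i / (lam x i - lam x a) * eigenvalueProduct b lam a x := by
  have hd : ∀ a, DifferentiableAt ℝ (fun y => lam y a) x := fun a =>
    differentiableAt_of_contDiffOn hg.isOpen (ha.lam_smooth a) hx
  have hne := ha.lam_ne hx (not_sameEigenspace_of_simple ha0 hi)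
  have := pderiv_prod_of_log (i := i) (x := x) ((simpleIndices b).erase a)
    (F := fun r y => lam y a - lam y r)
    (μ := fun r => if r = i then α x i / (lam x i - lam x a) else 0)
    (fun r _ => (hd a).fun_sub (hd r)) (fun r _ => by
      rw [pderiv_sub (hd a) (hd r), ha.pderiv_lam x hx, ha.pderiv_lam x hx, if_neg hi.symm]
      split_ifs with hr
      · subst hr
        field_simp
        ring
      · simp)
  refine this.trans ?_
  rw [eigenvalueProduct]
  congr 1
  by_cases h : b i = 0
  · simp [Finset.sum_ite_eq', hi, mem_simpleIndices, h]
  · simp [ha.alpha_eq_zero x hx i h]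

/-- In product coordinates the simple eigenvalues and the metric of `M_0` are separated. -/
theorem IsAdapted.exists_separated_form (ha : IsAdapted U g b lam α e) (hg : IsMetricOn U g)
    (ho : IsOrthogonal U g) (hε : Metric.ball x₀ ε ⊆ U) :
    ∃ m ψ : ι → ℝ → ℝ, (∀ a, b a = 0 → ContDiffOn ℝ ∞ (m a) (Metric.ball (x₀ a) ε) ∧
        ContDiffOn ℝ ∞ (ψ a) (Metric.ball (x₀ a) ε) ∧ ∀ t ∈ Metric.ball (x₀ a) ε, ψ a t ≠ 0) ∧
      ∀ x ∈ Metric.ball x₀ ε, ∀ a, b a = 0 →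
        lam x a = m a (x a) ∧ g x a a = ψ a (x a) * eigenvalueProduct b lam a x := by
  have hmaps : ∀ a, ∀ t ∈ Metric.ball (x₀ a) ε, Function.update x₀ a t ∈ U :=
    fun a t ht => hε (update_mem_ball ht)
  have hsm : ∀ (f : (ι → ℝ) → ℝ) (a : ι), ContDiffOn ℝ ∞ f U →
      ContDiffOn ℝ ∞ (fun t => f (Function.update x₀ a t)) (Metric.ball (x₀ a) ε) :=
    fun f a hf => hf.comp (contDiff_update ∞ x₀ a).contDiffOn (hmaps a)
  have hq : ∀ a, b a = 0 → ContDiffOn ℝ ∞ (fun x => g x a a / eigenvalueProduct b lam a x) U :=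
    fun a ha0 => (hg.smooth a a).div (ha.contDiffOn_eigenvalueProduct a)
      fun x hx => ha.eigenvalueProduct_ne_zero hx ha0
  -- The one-variable functions are obtained by freezing all other coordinates at `x₀`. This loses
  -- nothing, because `g_aa` and the eigenvalue product have the same logarithmic derivative in
  -- every direction other than `a`.
  refine ⟨fun a t => lam (Function.update x₀ a t) a, fun a t =>
    g (Function.update x₀ a t) a a / eigenvalueProduct b lam a (Function.update x₀ a t),
    fun a ha0 => ⟨hsm _ a (ha.lam_smooth a), hsm _ a (hq a ha0), fun t ht =>
      div_ne_zero (ho.ne_zero hg (hmaps a t ht) a)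
        (ha.eigenvalueProduct_ne_zero (hmaps a t ht) ha0)⟩, fun x hx a ha0 => ⟨?_, ?_⟩⟩
  · exact eq_update_of_pderiv_eq_zero (f := fun x => lam x a)
      (fun y hy => differentiableAt_of_contDiffOn hg.isOpen (ha.lam_smooth a) (hε hy))
      (fun y hy i hi => by rw [ha.pderiv_lam y (hε hy), if_neg hi.symm]) hx
  · have h := eq_update_of_pderiv_eq_zero (a := a)
      (f := fun x => g x a a / eigenvalueProduct b lam a x)
      (fun y hy => differentiableAt_of_contDiffOn hg.isOpen (hq a ha0) (hε hy))
      (fun y hy i hi => by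
        have h0 := ha.eigenvalueProduct_ne_zero (hε hy) ha0
        rw [pderiv_div (hg.differentiableAt (hε hy) a a) (differentiableAt_of_contDiffOn hg.isOpen
          (ha.contDiffOn_eigenvalueProduct a) (hε hy)) h0,
          ha.pderiv_eigenvalueProduct hg (hε hy) ha0 hi,
          ha.pderiv_diag (hε hy) (not_sameEigenspace_of_simple ha0 hi)]
        ring) hx
    exact (div_eq_iff (ha.eigenvalueProduct_ne_zero (hε hx) ha0)).1 h

end LocalForm

/-! ### Choice of parameters and separability of the product coordinates -/

section Separable

open Filter Topology

variable {ι : Type} [Fintype ι] [DecidableEq ι] {U : Set (ι → ℝ)} {g L : (ι → ℝ) → Matrix ι ι ℝ}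
  {k : ℕ} {b : ι → Fin (k + 1)} {lam α : (ι → ℝ) → ι → ℝ} {e : Fin (k + 1) → ℝ}

theorem prod_erase_sub_eq_zero {A : Finset ι} {v : ι → ℝ} {a j : ι} (ha : a ∈ A) (haj : a ≠ j) :
    ∏ q ∈ A.erase j, (v a - v q) = 0 :=
  Finset.prod_eq_zero (Finset.mem_erase.2 ⟨haj, ha⟩) (sub_self _)

/-- The separated momenta can be prescribed at a point by the choice of the parameters. -/
theorem momentumSq_eq_one {κ : Type} {A : Finset ι} {N : Finset κ} {e : κ → ℝ} {φ l : ℝ → ℝ}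
    {H : κ → (ι → ℝ) → ℝ} {v c : ι → ℝ} {a : ι} {t : ℝ} (ha : a ∈ A) (hl : l t = v a)
    (hφ : φ t ≠ 0) (hv : ∏ q ∈ A.erase a, (v a - v q) ≠ 0)
    (hc : c a = ((φ t)⁻¹ + ∑ I ∈ N, H I c / (e I - v a)) / ∏ q ∈ A.erase a, (v a - v q)) :
    momentumSq A N v e φ l H t c = 1 := by
  rw [momentumSq, hl, Finset.sum_eq_single a, hc]
  · field_simp
    ring
  · intro j _ hj
    rw [prod_erase_sub_eq_zero ha hj.symm, mul_zero]
  · exact fun h => absurd ha h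

/-- At the nodes themselves the Stäckel matrix is diagonal, since row `a` of column `j ≠ a` contains
the factor `v_a - v_a`. -/
theorem det_prod_erase_sub_ne_zero {v : ι → ℝ} (hv : Set.InjOn v (simpleIndices b)) :
    (Matrix.of fun a j : {a // b a = 0} =>
      ∏ q ∈ (simpleIndices b).erase j, (v a - v q)).det ≠ 0 := by
  rw [eq_diagonal_of_offDiag_eq_zero (A := Matrix.of fun a j : {a // b a = 0} =>
      ∏ q ∈ (simpleIndices b).erase j, (v a - v q)) fun a j haj =>
        prod_erase_sub_eq_zero (mem_simpleIndices.2 a.2) fun h => haj (Subtype.ext h),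
    Matrix.det_diagonal, Finset.prod_ne_zero_iff]
  intro a _
  refine Finset.prod_ne_zero_iff.2 fun q hq => sub_ne_zero.2 fun h => ?_
  exact Finset.ne_of_mem_erase hq
    (hv (Finset.mem_of_mem_erase hq) (mem_simpleIndices.2 a.2) h.symm)

theorem IsAdapted.injOn_lam (ha : IsAdapted U g b lam α e) {x : ι → ℝ} (hx : x ∈ U) :
    Set.InjOn (lam x) (simpleIndices b) := by
  intro a _ q hq h
  by_contra hne
  exact not_sameEigenspace_of_simple (mem_simpleIndices.1 hq) hne ((ha.lam_eq_iff x hx a q).1 h)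

/-- If the coordinates on all factors are separable, so are the product coordinates. -/
theorem IsAdapted.isSeparable (ha : IsAdapted U g b lam α e)
    (hb : IsAssociatedProduct U g L b) (hg : IsMetricOn U g) {p : Fin (k + 1) → ι → ℝ}
    (hp : ∀ I, p I ∈ U)
    (hoI : ∀ I, I ≠ 0 → IsOrthogonal (leafDomain b I (p I) U) (leafMetric b I (p I) g))
    (hs : ∀ I, I ≠ 0 → IsSeparable (leafDomain b I (p I) U) (leafMetric b I (p I) g)) :
    IsSeparable U g := by
  have ho := ha.isOrthogonal hb hg hp hoI
  intro x₀ hx₀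
  obtain ⟨ε, hε, hεU⟩ := Metric.isOpen_iff.1 hg.isOpen x₀ hx₀
  obtain ⟨m, ψ, hsm, hform⟩ := ha.exists_separated_form hg ho hεU
  -- Dummy data are supplied for `I = 0` so that the choices below are total functions of `I`.
  have hleaf : ∀ I, ∃ (V C : Set ({j // b j = I} → ℝ))
      (W : {j // b j = I} → ℝ → ({j // b j = I} → ℝ) → ℝ) (E : ({j // b j = I} → ℝ) → ℝ)
      (c : {j // b j = I} → ℝ), I ≠ 0 → IsOpen V ∧ restrictTo b I x₀ ∈ V ∧
        V ⊆ leafDomain b I (p I) U ∧ IsOpen C ∧ c ∈ C ∧ IsCompleteIntegral V C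
          (leafMetric b I (p I) g) (fun y c => ∑ j, W j (y j) c) E := by
    intro I
    by_cases hI : I = 0
    · exact ⟨∅, ∅, fun _ _ _ => 0, fun _ => 0, fun _ => 0, fun h => absurd hI h⟩
    · obtain ⟨V, hV, hxV, hVU, C, hC, ⟨c, hc⟩, W, E, hS⟩ :=
        hs I hI (restrictTo b I x₀) (hb.leafPoint_mem (hp I) hx₀)
      exact ⟨V, C, W, E, c, fun _ => ⟨hV, hxV, hVU, hC, hc, hS⟩⟩
  choose Vf Cf Wf Ef cf hf using hleaf
  have hVo := fun I hI => (hf I hI).1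
  have hxV := fun I hI => (hf I hI).2.1
  have hVU := fun I hI => (hf I hI).2.2.1
  have hCo := fun I hI => (hf I hI).2.2.2.1
  have hcC := fun I hI => (hf I hI).2.2.2.2.1
  have hS := fun I hI => (hf I hI).2.2.2.2.2
  let r : Fin (k + 1) → ℝ := fun I => warpingFunction b lam (e I) (p I)
  -- Taking the eigenvalues at `x₀` as nodes diagonalizes the dependence of the momenta at `x₀` on
  -- the parameters of `M_0`.
  let w : ι → ℝ := lam x₀
  let H := factorEnergy b r Ef
  let N : Finset (Fin (k + 1)) := Finset.univ.erase 0
  let c' : ι → ℝ := fun i => cf (b i) ⟨i, rfl⟩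
  -- The factor parameters are fixed first in `c'`. As the energies `H I` see only those, each
  -- remaining parameter can be solved for explicitly from the requirement that its squared momentum
  -- be `1` at `x₀`.
  let c₀ : ι → ℝ := fun i => if b i = 0 then
    ((ψ i (x₀ i))⁻¹ + ∑ I ∈ N, H I c' / (e I - w i))
      / ∏ q ∈ (simpleIndices b).erase i, (w i - w q) else c' i
  have hc₀ : ∀ I, I ≠ 0 → restrictTo b I c₀ = cf I := by
    intro I hI
    funext ⟨j, hj⟩
    subst hj
    simp [restrictTo, c₀, c', hI]
  have hc' : ∀ I, restrictTo b I c' = cf I := by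
    intro I
    funext ⟨j, hj⟩
    subst hj
    rfl
  have hHc : ∀ I ∈ N, H I c₀ = H I c' := by
    intro I hI
    change 2 * r I * Ef I (restrictTo b I c₀) = 2 * r I * Ef I (restrictTo b I c')
    rw [hc₀ I (Finset.ne_of_mem_erase hI), hc']
  have hx₀ball := Metric.mem_ball_self (x := x₀) hε
  have hball : ∀ x ∈ Metric.ball x₀ ε, ∀ a, x a ∈ Metric.ball (x₀ a) ε := fun x hx a =>
    (dist_le_pi_dist x x₀ a).trans_lt hx
  have hsub : ∀ I, I ≠ 0 → ∀ a, b a = 0 → ∀ t ∈ Metric.ball (x₀ a) ε, e I - m a t ≠ 0 := by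
    intro I hI a ha0 t ht
    have hmem := update_mem_ball ht
    have := ha.sub_lam_ne_zero hb (hεU hmem) hI ha0
    rwa [(hform _ hmem a ha0).1, Function.update_self] at this
  have hinj : ∀ x ∈ Metric.ball x₀ ε, Set.InjOn (fun a => m a (x a)) (simpleIndices b) :=
    fun x hx => (ha.injOn_lam (hεU hx)).congr fun a h =>
      (hform x hx a (mem_simpleIndices.1 h)).1
  let C' : Set (ι → ℝ) := {c | ∀ I, I ≠ 0 → restrictTo b I c ∈ Cf I}
  have hC' : IsOpen C' := by
    have : C' = ⋂ I, ⋂ _ : I ≠ 0, restrictTo b I ⁻¹' Cf I := by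
      ext c; simp [C']
    rw [this]
    exact isOpen_iInter_of_finite fun I => isOpen_iInter_of_finite fun hI =>
      (hCo I hI).preimage contDiff_restrictTo.continuous
  have hc₀C' : c₀ ∈ C' := fun I hI => by rw [hc₀ I hI]; exact hcC I hI
  have hQ : ∀ a, b a = 0 → ∀ᶠ q : (ι → ℝ) × (ι → ℝ) in 𝓝 (x₀, c₀),
      0 < momentumSq (simpleIndices b) N w e (ψ a) (m a) H (q.1 a) q.2 := by
    intro a ha0
    have hcont : ContinuousAt (fun q : ℝ × (ι → ℝ) =>
        momentumSq (simpleIndices b) N w e (ψ a) (m a) H q.1 q.2) (x₀ a, c₀) :=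
      (contDiffOn_momentumSq (hsm a ha0).2.1 (hsm a ha0).1 (C := C')
        (fun I hI => contDiffOn_const.mul ((IsCompleteIntegral.contDiffOn_energy
          (hVo I (Finset.ne_of_mem_erase hI)) (hCo I (Finset.ne_of_mem_erase hI))
          (hS I (Finset.ne_of_mem_erase hI)) ⟨_, hxV I (Finset.ne_of_mem_erase hI)⟩).comp
            contDiff_restrictTo.contDiffOn fun c hc => hc I (Finset.ne_of_mem_erase hI)))
        (fun t ht I hI => hsub I (Finset.ne_of_mem_erase hI) a ha0 t ht)).continuousOn.continuousAt
        ((Metric.isOpen_ball.prod hC').mem_nhds ⟨Metric.mem_ball_self hε, hc₀C'⟩)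
    have hcomp : ContinuousAt (fun q : (ι → ℝ) × (ι → ℝ) =>
        momentumSq (simpleIndices b) N w e (ψ a) (m a) H (q.1 a) q.2) (x₀, c₀) :=
      ContinuousAt.comp (x := (x₀, c₀)) (f := fun q : (ι → ℝ) × (ι → ℝ) => (q.1 a, q.2))
        (g := fun q : ℝ × (ι → ℝ) => momentumSq (simpleIndices b) N w e (ψ a) (m a) H q.1 q.2)
        hcont (Continuous.continuousAt (by fun_prop))
    refine hcomp.eventually_const_lt (u := 0) ?_
    have hone : momentumSq (simpleIndices b) N w e (ψ a) (m a) H (x₀ a) c₀ = 1 := by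
      refine momentumSq_eq_one (mem_simpleIndices.2 ha0) (hform x₀ hx₀ball a ha0).1.symm
        ((hsm a ha0).2.2 _ (Metric.mem_ball_self hε)) (ha.eigenvalueProduct_ne_zero hx₀ ha0) ?_
      rw [Finset.sum_congr rfl fun I hI => by rw [hHc I hI]]
      simp [c₀, ha0]
    exact one_pos.trans_eq hone.symm
  have hdet : ∀ᶠ x in 𝓝 x₀, (Matrix.of fun a j : {a // b a = 0} =>
      ∏ q ∈ (simpleIndices b).erase j, (m a (x a) - w q)).det ≠ 0 := by
    have hm : ∀ a : {a // b a = 0}, ContinuousAt (fun x : ι → ℝ => m a (x a)) x₀ := fun a =>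
      ContinuousAt.comp (f := fun x : ι → ℝ => x a.1)
        ((hsm a a.2).1.continuousOn.continuousAt
          (Metric.isOpen_ball.mem_nhds (Metric.mem_ball_self hε))) (continuous_apply a.1).continuousAt
    have hM : ContinuousAt (fun x : ι → ℝ => Matrix.of fun a j : {a // b a = 0} =>
        ∏ q ∈ (simpleIndices b).erase j, (m a (x a) - w q)) x₀ :=
      continuousAt_pi.2 fun a => continuousAt_pi.2 fun j =>
        tendsto_finsetProd _ fun q _ => (hm a).sub continuousAt_const
    have hcont := ContinuousAt.comp (g := Matrix.det)
      (continuous_id.matrix_det.continuousAt) hM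
    refine hcont.eventually_ne ?_
    have heq : (Matrix.of fun a j : {a // b a = 0} =>
        ∏ q ∈ (simpleIndices b).erase j, (m a (x₀ a) - w q)) = Matrix.of fun a j : {a // b a = 0} =>
        ∏ q ∈ (simpleIndices b).erase j, (w a - w q) := by
      ext a j
      simp only [Matrix.of_apply, ← (hform x₀ hx₀ball a a.2).1]
      rfl
    rw [Function.comp_apply, heq]
    exact det_prod_erase_sub_ne_zero (ha.injOn_lam hx₀)
  -- All requirements hold at `(x₀, c₀)` and are stable under small perturbation, so a single radius
  -- `δ` serves for both points and parameters.
  have hall : ∀ᶠ q : (ι → ℝ) × (ι → ℝ) in 𝓝 (x₀, c₀), q.1 ∈ Metric.ball x₀ ε ∧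
      (∀ I, I ≠ 0 → restrictTo b I q.1 ∈ Vf I) ∧ q.2 ∈ C' ∧
      (∀ a, b a = 0 → 0 < momentumSq (simpleIndices b) N w e (ψ a) (m a) H (q.1 a) q.2) ∧
      (Matrix.of fun a j : {a // b a = 0} =>
        ∏ q' ∈ (simpleIndices b).erase j, (m a (q.1 a) - w q')).det ≠ 0 := by
    refine .and ?_ (.and ?_ (.and ?_ (.and ?_ ?_)))
    · exact continuousAt_fst.eventually (Metric.ball_mem_nhds x₀ hε)
    · rw [eventually_all]
      intro I
      by_cases hI : I = 0
      · exact .of_forall fun _ h => absurd hI h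
      · have := (contDiff_restrictTo (b := b) (I := I)).continuous.comp
          (continuous_fst (X := ι → ℝ) (Y := ι → ℝ))
        filter_upwards [this.continuousAt.eventually ((hVo I hI).mem_nhds (hxV I hI))] with q hq _
        exact hq
    · exact continuousAt_snd.eventually (hC'.mem_nhds hc₀C')
    · rw [eventually_all]
      intro a
      by_cases ha0 : b a = 0
      · filter_upwards [hQ a ha0] with q hq _ using hq
      · exact .of_forall fun _ h => absurd h ha0
    · exact (continuousAt_fst (p := (x₀, c₀))).eventually hdet
  obtain ⟨δ, hδ, hδall⟩ := Metric.eventually_nhds_iff_ball.1 hall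
  have hpair : ∀ x ∈ Metric.ball x₀ δ, ∀ c ∈ Metric.ball c₀ δ,
      ((x, c) : (ι → ℝ) × (ι → ℝ)) ∈ Metric.ball (x₀, c₀) δ := fun x hx c hc => by
    rw [← ball_prod_same]; exact ⟨hx, hc⟩
  have hc₀δ := Metric.mem_ball_self (x := c₀) hδ
  have hx₀δ := Metric.mem_ball_self (x := x₀) hδ
  have hxε : ∀ x ∈ Metric.ball x₀ δ, x ∈ Metric.ball x₀ ε := fun x hx =>
    (hδall _ (hpair x hx c₀ hc₀δ)).1
  have htε : ∀ a, Metric.ball (x₀ a) δ ⊆ Metric.ball (x₀ a) ε := fun a t ht => by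
    simpa using hball _ (hxε _ (update_mem_ball ht)) a
  let D : SeparationDatum g b :=
    { x₀ := x₀, c₀ := c₀, δ := δ, m := m, ψ := ψ, w := w, e := e, r := r
      γ := fun I => leafMetric b I (p I) g
      Vf := Vf, Cf := Cf, Wf := Wf, Ef := Ef
      pos := hδ
      isOpen_V := hVo
      isOpen_C := hCo
      integral := hS
      mem_V := fun x hx => (hδall _ (hpair x hx c₀ hc₀δ)).2.1
      mem_C := fun c hc => (hδall _ (hpair x₀ hx₀δ c hc)).2.2.1
      m_smooth := fun a ha0 => (hsm a ha0).1.mono (htε a)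
      ψ_smooth := fun a ha0 => (hsm a ha0).2.1.mono (htε a)
      momentum_pos := fun a ha0 t ht c hc => by
        simpa using (hδall _ (hpair _ (update_mem_ball ht) c hc)).2.2.2.1 a ha0
      ψ_ne := fun a ha0 t ht => (hsm a ha0).2.2 t (htε a ht)
      sub_ne := fun I hI a ha0 t ht => hsub I hI a ha0 t (htε a ht)
      injOn := fun x hx => hinj x (hxε x hx)
      metric_simple := fun x hx a ha0 => by
        rw [(hform x (hxε x hx) a ha0).2, eigenvalueProduct]
        congr 1
        refine Finset.prod_congr rfl fun q hq => ?_
        rw [(hform x (hxε x hx) a ha0).1, (hform x (hxε x hx) q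
          (mem_simpleIndices.1 (Finset.mem_of_mem_erase hq))).1]
      metric_factor := fun x hx I hI j => by
        rw [ha.metric_eq_warped hb hg (hεU (hxε x hx)) (hp I) hI j j]
        congr 2
        refine Finset.prod_congr rfl fun a h => ?_
        rw [(hform x (hxε x hx) a (mem_simpleIndices.1 h)).1]
      r_ne := fun I hI => ha.warpingFunction_ne_zero hb (hp I) hI
      orthogonal := fun x hx => ho x (hεU (hxε x hx))
      det_ne := fun x hx => hg.det_ne_zero x (hεU (hxε x hx))
      factor_orthogonal := fun I hI y hy => hoI I hI y (hVU I hI hy)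
      factor_det_ne := fun I hI y hy => ha.leafMetric_det_ne_zero hg (hVU I hI hy)
      stackel_det_ne := fun x hx => (hδall _ (hpair x hx c₀ hc₀δ)).2.2.2.2 }
  exact ⟨Metric.ball x₀ δ, Metric.isOpen_ball, hx₀δ, fun x hx => hεU (hxε x hx),
    Metric.ball c₀ δ, Metric.isOpen_ball, ⟨c₀, hc₀δ⟩, D.W, D.E, D.isCompleteIntegral⟩

end Separable

/-! ### KEM coordinates -/

/-- Induction on the KEM structure, with the Lamé equations in place of the curvature condition
because they transfer directly from leaf metrics to the warped blocks. Leaf metrics are again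
metrics, and all three properties are local. -/
theorem IsKEM.isOrthogonal_and_isSeparable_and_satisfiesLame {ι : Type} [Fintype ι]
    [DecidableEq ι] {U : Set (ι → ℝ)} {g : (ι → ℝ) → Matrix ι ι ℝ} (h : IsKEM U g)
    (hg : IsMetricOn U g) : IsOrthogonal U g ∧ IsSeparable U g ∧ SatisfiesLame U g := by
  induction h with
  | ofOCT L oct _ b prod p mem _ ih =>
    obtain ⟨lam, α, e, ha⟩ := oct.toIsConcircular.exists_isAdapted hg prod
    have ih' := fun I hI => ih I hI (ha.isMetricOn_leafMetric hg)
    have ho := ha.isOrthogonal prod hg mem fun I hI => (ih' I hI).1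
    exact ⟨ho, ha.isSeparable prod hg mem (fun I hI => (ih' I hI).1) fun I hI => (ih' I hI).2.1,
      ha.satisfiesLame prod hg mem ho fun I hI => (ih' I hI).2.2⟩
  | ofLocal V nhd _ ih =>
    have ih' := fun x hx => ih x hx (hg.mono (nhd x hx).1 (nhd x hx).2.2)
    refine ⟨fun x hx => (ih' x hx).1 x (nhd x hx).2.1, fun x hx => ?_,
      fun x hx => (ih' x hx).2.2 x (nhd x hx).2.1⟩
    obtain ⟨V', h1, h2, h3, h4⟩ := (ih' x hx).2.1 x (nhd x hx).2.1
    exact ⟨V', h1, h2, h3.trans (nhd x hx).2.2, h4⟩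

/-! ### The metric components in a coordinate system -/

section Manifold

variable {n : ℕ} {M : Type*} [TopologicalSpace M] [ChartedSpace (EuclideanSpace ℝ (Fin n)) M]
  [IsManifold (𝓡 n) ∞ M] {φ : OpenPartialHomeomorph M (Fin n → ℝ)}

theorem IsCoordinateSystem.contMDiffOn_coordVector (hφ : IsCoordinateSystem φ) (i : Fin n) :
    ContMDiffOn 𝓘(ℝ, Fin n → ℝ) (𝓡 n).tangent ∞ (fun y => (Bundle.TotalSpace.mk'
      (EuclideanSpace ℝ (Fin n)) (φ.symm y) (coordVector φ y i) : TangentBundle (𝓡 n) M))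
      φ.target := by
  have h1 := hφ.smooth_symm.contMDiffOn_tangentMapWithin (m := ∞) (by simp)
    φ.open_target.uniqueMDiffOn
  have h2 : ContMDiff 𝓘(ℝ, Fin n → ℝ) (𝓘(ℝ, Fin n → ℝ)).tangent ∞
      (fun y : Fin n → ℝ => (Bundle.TotalSpace.mk' (Fin n → ℝ) y (Pi.single i 1 : Fin n → ℝ) :
        TangentBundle 𝓘(ℝ, Fin n → ℝ) (Fin n → ℝ))) := by
    exact contMDiff_vectorSpace_iff_contDiff.2
      (contDiff_const (c := (Pi.single i 1 : Fin n → ℝ)))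
  refine (h1.comp h2.contMDiffOn fun y hy => hy).congr fun y hy => ?_
  simp only [Function.comp, tangentMapWithin, coordVector]
  rw [mfderivWithin_of_isOpen φ.open_target hy]

theorem IsCoordinateSystem.contDiffOn_metricComponents (hφ : IsCoordinateSystem φ)
    (g : PseudoRiemannianMetric n M) (i j : Fin n) :
    ContDiffOn ℝ ∞ (fun y => metricComponents g φ y i j) φ.target := by
  rw [← contMDiffOn_iff_contDiffOn]
  intro y hy
  have : ContMDiffWithinAt 𝓘(ℝ, Fin n → ℝ) ((𝓡 n).prod 𝓘(ℝ, ℝ)) ∞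
      (fun y ↦ Bundle.TotalSpace.mk' ℝ (E := Bundle.Trivial M ℝ) (φ.symm y)
        (g.inner (φ.symm y) (coordVector φ y i) (coordVector φ y j))) φ.target y := by
    apply ContMDiffWithinAt.clm_bundle_apply₂ (F₁ := EuclideanSpace ℝ (Fin n))
      (F₂ := EuclideanSpace ℝ (Fin n))
    · exact ContMDiffAt.comp_contMDiffWithinAt y g.contMDiff.contMDiffAt (hφ.smooth_symm y hy)
    · exact hφ.contMDiffOn_coordVector i y hy
    · exact hφ.contMDiffOn_coordVector j y hy
  simp only [Bundle.contMDiffWithinAt_totalSpace] at this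
  exact this.2

theorem IsCoordinateSystem.mfderiv_comp_mfderiv_symm (hφ : IsCoordinateSystem φ) {y : Fin n → ℝ}
    (hy : y ∈ φ.target) (v : Fin n → ℝ) :
    mfderiv (𝓡 n) 𝓘(ℝ, Fin n → ℝ) φ (φ.symm y)
      (mfderiv 𝓘(ℝ, Fin n → ℝ) (𝓡 n) φ.symm y v) = v := by
  have h1 : MDifferentiableAt 𝓘(ℝ, Fin n → ℝ) (𝓡 n) φ.symm y :=
    (hφ.smooth_symm.contMDiffAt (φ.open_target.mem_nhds hy)).mdifferentiableAt (by simp)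
  have h2 : MDifferentiableAt (𝓡 n) 𝓘(ℝ, Fin n → ℝ) φ (φ.symm y) :=
    (hφ.smooth.contMDiffAt (φ.open_source.mem_nhds (φ.map_target hy))).mdifferentiableAt (by simp)
  have h3 := mfderiv_comp y h2 h1
  have h4 : (φ ∘ φ.symm) =ᶠ[nhds y] id :=
    Filter.eventuallyEq_of_mem (φ.open_target.mem_nhds hy) fun z hz => φ.right_inv hz
  rw [h4.mfderiv_eq, mfderiv_id] at h3
  exact (DFunLike.congr_fun h3 v).symm

theorem IsCoordinateSystem.isMetricOn_metricComponents (hφ : IsCoordinateSystem φ)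
    (g : PseudoRiemannianMetric n M) : IsMetricOn φ.target (metricComponents g φ) where
  isOpen := φ.open_target
  smooth := hφ.contDiffOn_metricComponents g
  symm _ _ _ _ := g.symm _ _ _
  det_ne_zero y hy h0 := by
    obtain ⟨v, hv, hv0⟩ := Matrix.exists_vecMul_eq_zero_iff.2 h0
    -- A kernel vector `v` of the matrix yields a tangent vector `T v` orthogonal to every
    -- coordinate vector. `T` is injective, having a left inverse, and onto by dimension; so `T v`
    -- is orthogonal to everything and nondegeneracy of `g` applies.
    let T : (Fin n → ℝ) →ₗ[ℝ] EuclideanSpace ℝ (Fin n) :=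
      (mfderiv 𝓘(ℝ, Fin n → ℝ) (𝓡 n) φ.symm y).toLinearMap
    have hinj : Function.Injective T := Function.LeftInverse.injective
      (g := mfderiv (𝓡 n) 𝓘(ℝ, Fin n → ℝ) φ (φ.symm y)) (hφ.mfderiv_comp_mfderiv_symm hy)
    have hsurj : Function.Surjective T :=
      (LinearMap.injective_iff_surjective_of_finrank_eq_finrank (by simp)).1 hinj
    have hT : ∀ u : Fin n → ℝ, T u = ∑ i, u i • T (Pi.single i 1) := by
      intro u
      conv_lhs => rw [pi_eq_sum_univ' u, map_sum]
      simp only [map_smul]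
    let B : EuclideanSpace ℝ (Fin n) →L[ℝ] EuclideanSpace ℝ (Fin n) →L[ℝ] ℝ := g.inner (φ.symm y)
    have hB : ∀ j, B (T v) (T (Pi.single j 1)) = 0 := by
      intro j
      rw [hT v]
      simp only [map_sum, map_smul, sum_apply, smul_apply]
      exact congrFun hv0 j
    have hTv : T v = 0 := g.nondegenerate (φ.symm y) (T v) fun u => by
      obtain ⟨u, rfl⟩ := hsurj u
      change B (T v) (T u) = 0
      rw [hT u, map_sum]
      refine Finset.sum_eq_zero fun j _ => ?_
      rw [map_smul, hB, smul_zero]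
    exact hv (hinj (hTv.trans (map_zero T).symm))

end Manifold

end KEM

theorem mainTheorem4 {n : ℕ} {M : Type*} [TopologicalSpace M]
    [ChartedSpace (EuclideanSpace ℝ (Fin n)) M] [IsManifold (𝓡 n) ∞ M]
    (g : KEM.PseudoRiemannianMetric n M) (φ : OpenPartialHomeomorph M (Fin n → ℝ))
    (hφ : KEM.IsCoordinateSystem φ)
    (hKEM : KEM.IsKEM φ.target (KEM.metricComponents g φ)) :
    KEM.IsOrthogonal φ.target (KEM.metricComponents g φ) ∧
    KEM.IsSeparable φ.target (KEM.metricComponents g φ) ∧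
    KEM.IsDiagonalCurvature φ.target (KEM.metricComponents g φ) := by
  have hg := hφ.isMetricOn_metricComponents g
  obtain ⟨ho, hs, hl⟩ := hKEM.isOrthogonal_and_isSeparable_and_satisfiesLame hg
  exact ⟨ho, hs, ho.isDiagonalCurvature hg hl⟩
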